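/- **Setting.** Let $V$ be a Euclidean space of finite dimension $d\ge 1$ with norm $|\cdot|_V$, let $X$ be a $V$-valued and $Y$ a complex-valued random variable on a probability space with $0<\mathbb E|Y|^2<\infty$, and let $\lambda,\epsilon>0$. Let $k_V(\omega)=k(|\omega|^2)>0$ be a rotationally invariant function with $\int k_V\,d\omega=1$, whose kernel function is $K(x)=\int e^{2\pi i\langle x,\omega\rangle}k_V(\omega)\,d\omega=\mathcal K(|x|_V^2)$, and let $\mathcal H=\{f:\|f\|_{\mathcal H}^2=\int|\hat f|^2/k_V\,d\omega<\infty\}$. For $U\in\mathrm{End}(V)$ put $J(U,\lambda)=\inf_{f\in\mathcal H}\big(\tfrac12\mathbb E|Y-f(UX)|^2+\tfrac\lambda2\|f\|_{\mathcal H}^2\big)$. It depends only on the semi-definite form $\Sigma=U^TU$, and we write $\mathcal J(\Sigma)=J(U,\lambda)$. Let $Sym^2_{\ge0}$ (resp. $Sym^2_+$) be the set of positive semi-definite (resp. positive definite) symmetric bilinear forms on $V$, with the partial order given by comparing quadratic forms. The partial compactification of $Sym^2_{\ge0}$ adds the points at infinity $(W,\Sigma_W)$, with $W\subsetneq V$ a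 subspace and $\Sigma_W$ a semi-definite form on $W$. Forms $\Sigma_i\in Sym^2_+$ converge to $(W,\Sigma_W)$ if $\Sigma_i|_W\to\Sigma_W$ and the quotient forms on $V/W$ are bounded below by $R_i^2$ times the ambient one with $R_i\to\infty$; $\mathcal J$ is extended to points at infinity by continuity. A *global minimizing vacuum* is a global minimizer of the extended $\mathcal J$. For $\Sigma\in Sym^2_+$ and $\Lambda>0$ put $\mathcal N(\Sigma,\Lambda)=\{\Sigma'\in Sym^2_+:\Lambda^{-1}\Sigma\le\Sigma'\le\Lambda\Sigma\}$. For $\Lambda>1$, a local minimizer $\Sigma\in Sym^2_+$ of $\mathcal J$ on $Sym^2_{\ge0}$ is an *$(\epsilon,\Lambda)$-scale detector* if $\mathcal J(\Sigma')\ge\mathcal J(\Sigma)$ for all $\Sigma'\in\mathcal N(\Sigma,\Lambda)$ and $\mathcal J(\Sigma')\ge\mathcal J(\Sigma)+\epsilon\,\mathbb E|Y|^2$ for all $\Sigma'\in\partial\mathcal N(\Sigma,\Lambda)$. **Theorem.** Assume: 1. (Essential dependence) $\displaystyle\inf_{Sym^2_+}\mathcal J\le\inf_{Sym^2_{\ge0}\setminus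 Sym^2_+}\mathcal J-2\epsilon\,\mathbb E|Y|^2$. 2. $\beta:=\sup_{|\omega|=1}\mathbb E[|\langle X,\omega\rangle|^4]^{1/2}<\infty$, and $\mathcal K$ is differentiable on $[0,\infty)$ with $\mathcal K'$ bounded and continuous. 3. $\mathcal K(r)=\int_0^\infty e^{-tr}\,d\nu(t)$ for a finite measure $\nu$ on $[0,\infty)$ (complete monotonicity), with $C_{\mathcal K}:=\iint(\pi/(t+s))^{1/2}\,d\nu(t)\,d\nu(s)<\infty$. 4. For every unit vector $\xi\in V$ the random variable $\langle X,\xi\rangle$ has a probability density bounded by $p_0$. Let $$\Lambda=\max\Big(\frac{\beta\,\|\mathcal K'\|_{C^0}}{2\epsilon\lambda},\ (C_{\mathcal K}p_0)^2(\lambda\epsilon)^{-4}\Big).$$ Then every global minimizing vacuum is a point $\Sigma_0\in Sym^2_+$ with $\Sigma_0\in\mathcal N(|\cdot|_V^2,\Lambda)$, and $\Sigma_0$ is an $(\epsilon,\Lambda^2)$-scale detector (in particular $\Lambda>1$). -/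

import Mathlib

open MeasureTheory Filter Topology Set
open scoped NNReal ENNReal FourierTransform RealInnerProductSpace

noncomputable section

namespace KernelLearning

/-! ### Translation invariant reproducing kernel Hilbert spaces -/

section RKHS

variable {V : Type*} [NormedAddCommGroup V] [InnerProductSpace ℝ V] [FiniteDimensional ℝ V]
  [MeasurableSpace V] [BorelSpace V]

/-- The squared norm `‖f‖²_ℋ = ∫ |f̂(ω)|² / k_V(ω) dω`, with value `∞` if `f` is not in `ℋ`.
The Fourier transform of `f` is the (a.e. unique) integrable `g` with
`f(x) = ∫ g(ω) e^{2πi⟨x,ω⟩} dω`; it exists for every `f ∈ ℋ`, because `k_V` is integrable. -/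
def rkhsNormSq (kV : V → ℝ) (f : V → ℂ) : ℝ≥0∞ :=
  ⨅ (g : V → ℂ) (_ : Integrable g) (_ : f = 𝓕⁻ g), ∫⁻ ω, ‖g ω‖ₑ ^ 2 / ENNReal.ofReal (kV ω)

/-- The Hilbert space `ℋ`, as a set of functions on `V`. -/
def rkhs (kV : V → ℝ) : Set (V → ℂ) := {f | rkhsNormSq kV f < ∞}

/-- The kernel function `K(x) = ∫ e^{2πi⟨x,ω⟩} k_V(ω) dω`. -/
def kernelFn (kV : V → ℝ) : V → ℂ := 𝓕⁻ (fun ω => (kV ω : ℂ))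

/-- `k_V` is a strictly positive, rotationally invariant weight of total mass one, whose kernel
function is `K(x) = 𝒦(|x|²)`. -/
structure IsRadialKernel (kV : V → ℝ) (K : ℝ → ℝ) : Prop where
  pos : ∀ ω, 0 < kV ω
  integrable : Integrable kV
  integral_eq_one : ∫ ω, kV ω = 1
  radial : ∃ k : ℝ → ℝ, ∀ ω, kV ω = k (‖ω‖ ^ 2)
  kernel_eq : ∀ x, kernelFn kV x = (K (‖x‖ ^ 2) : ℂ)

variable {Ω : Type*} [MeasurableSpace Ω]

/-- The loss `I(f, U, lam) = ½ 𝔼|Y - f(UX)|² + (lam/2) ‖f‖²_ℋ` for `f ∈ ℋ`. -/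
def loss (kV : V → ℝ) (P : Measure Ω) (X : Ω → V) (Y : Ω → ℂ) (lam : ℝ)
    (f : V → ℂ) (U : V →L[ℝ] V) : ℝ :=
  1 / 2 * ∫ a, ‖Y a - f (U (X a))‖ ^ 2 ∂P + lam / 2 * (rkhsNormSq kV f).toReal

/-- `J(U, lam) = inf_{f ∈ ℋ} I(f, U, lam)`. -/
def minLoss (kV : V → ℝ) (P : Measure Ω) (X : Ω → V) (Y : Ω → ℂ) (lam : ℝ)
    (U : V →L[ℝ] V) : ℝ :=
  sInf ((fun f => loss kV P X Y lam f U) '' rkhs kV)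

end RKHS

/-! ### Symmetric forms -/

section Forms

variable {V : Type*} [NormedAddCommGroup V] [InnerProductSpace ℝ V]

/-- `Sym² V*`, the space of symmetric bilinear forms on `V`, with its usual topology. -/
abbrev Sym2Dual (V : Type*) [NormedAddCommGroup V] [InnerProductSpace ℝ V] :
    Submodule ℝ (V →L[ℝ] V →L[ℝ] ℝ) where
  carrier := {B | ∀ x y, B x y = B y x}
  add_mem' := by
    intro A B hA hB x y
    simp only [add_apply]
    rw [hA x y, hB x y]
  zero_mem' := by
    intro x y
    simp
  smul_mem' := by
    intro c B hB x y
    simp only [smul_apply]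
    rw [hB x y]

/-- The value `|x|²_S = S(x, x)`. -/
def formSq (S : Sym2Dual V) (x : V) : ℝ := (S : V →L[ℝ] V →L[ℝ] ℝ) x x

/-- The partial order on symmetric forms. -/
def FormLE (S T : Sym2Dual V) : Prop := ∀ x, formSq S x ≤ formSq T x

/-- `Sym²_{≥0}`: the semi-definite forms. -/
def symNonneg (V : Type*) [NormedAddCommGroup V] [InnerProductSpace ℝ V] : Set (Sym2Dual V) :=
  {S | ∀ x, 0 ≤ formSq S x}

/-- `Sym²_+`: the inner products. -/
def symPos (V : Type*) [NormedAddCommGroup V] [InnerProductSpace ℝ V] : Set (Sym2Dual V) :=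
  {S | ∀ x, x ≠ 0 → 0 < formSq S x}

/-- The ambient inner product `|·|²_V`. -/
def ambientForm (V : Type*) [NormedAddCommGroup V] [InnerProductSpace ℝ V] : Sym2Dual V :=
  ⟨innerSL ℝ, fun x y => real_inner_comm y x⟩

/-- `S = Uᵀ U`. -/
def IsGramOf (S : Sym2Dual V) (U : V →L[ℝ] V) : Prop :=
  ∀ x y, (S : V →L[ℝ] V →L[ℝ] ℝ) x y = ⟪U x, U y⟫

/-- The neighbourhood `𝒩(S, Λ)` of the inner product `S`. -/
def nbhd (S : Sym2Dual V) (L : ℝ) : Set (Sym2Dual V) :=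
  {T | T ∈ symPos V ∧ FormLE (L⁻¹ • S) T ∧ FormLE T (L • S)}

/-- The partial compactification of `Sym²_{≥0}`: its points are the semi-definite forms, and the
points at infinity `(W, S_W)` with `W` a proper subspace and `S_W` a semi-definite form on `W`. -/
inductive PartialCompactification (V : Type*) [NormedAddCommGroup V] [InnerProductSpace ℝ V]
  | form (S : Sym2Dual V) (hS : S ∈ symNonneg V) : PartialCompactification V
  | infinity (W : Submodule ℝ V) (hW : W ≠ ⊤) (SW : Sym2Dual W) (hSW : SW ∈ symNonneg W) :
      PartialCompactification V

/-- The sequence `S i` of inner products converges to the point at infinity `(W, S_W)`: the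
restrictions to `W` converge to `S_W`, and the quotient inner products on `V/W` (with squared norm
`min_{y ∈ W} |x + y|²_{S i}` at the class of `x ∈ Wᗮ`) are bounded below by `(R i)²` times the
ambient one, with `R i → ∞`. -/
def TendstoInfinity (S : ℕ → Sym2Dual V) (W : Submodule ℝ V) (SW : Sym2Dual W) : Prop :=
  (∀ i, S i ∈ symPos V) ∧
  (∀ x y : W, Tendsto (fun i => (S i : V →L[ℝ] V →L[ℝ] ℝ) x y) atTop
    (𝓝 ((SW : W →L[ℝ] W →L[ℝ] ℝ) x y))) ∧
  ∃ R : ℕ → ℝ, Tendsto R atTop atTop ∧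
    ∀ i, ∀ x ∈ Wᗮ, ∀ y ∈ W, R i ^ 2 * ‖x‖ ^ 2 ≤ formSq (S i) (x + y)

end Forms

/-! ### The functional on forms, its vacua and scale detectors -/

section Functional

variable {V : Type*} [NormedAddCommGroup V] [InnerProductSpace ℝ V] [FiniteDimensional ℝ V]
  [MeasurableSpace V] [BorelSpace V] {Ω : Type*} [MeasurableSpace Ω]

open Classical in
/-- `𝒥(S; lam) = J(U, lam)` for any `U` with `S = Uᵀ U`. Such `U` exists exactly for semi-definite
`S`, and for rotationally invariant kernels the value does not depend on its choice. -/
def formLoss (kV : V → ℝ) (P : Measure Ω) (X : Ω → V) (Y : Ω → ℂ) (lam : ℝ)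
    (S : Sym2Dual V) : ℝ :=
  if h : ∃ U : V →L[ℝ] V, IsGramOf S U then minLoss kV P X Y lam h.choose else 0

/-- `v` is the value at a point of the partial compactification of the continuous extension of the
function `J` on forms. -/
def HasExtendedValue (J : Sym2Dual V → ℝ) : PartialCompactification V → ℝ → Prop
  | .form S _, v => J S = v
  | .infinity W _ SW _, v =>
      ∀ S : ℕ → Sym2Dual V, TendstoInfinity S W SW → Tendsto (fun i => J (S i)) atTop (𝓝 v)

/-- `p` is a global minimizer on the partial compactification. -/
def IsGlobalMinimizingVacuum (J : Sym2Dual V → ℝ) (p : PartialCompactification V) : Prop :=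
  ∃ v, HasExtendedValue J p v ∧ ∀ q w, HasExtendedValue J q w → v ≤ w

/-- The inner product `S` is an `(eps, L)`-scale detector for the functional `J`, where `m` stands
for `𝔼|Y|²`. The boundary of the neighbourhood is its topological boundary in `Sym² V*`. -/
structure IsScaleDetector (J : Sym2Dual V → ℝ) (m eps L : ℝ) (S : Sym2Dual V) : Prop where
  eps_pos : 0 < eps
  one_lt : 1 < L
  mem_symPos : S ∈ symPos V
  vacuum : IsLocalMinOn J (symNonneg V) S
  local_min : ∀ T ∈ nbhd S L, J S ≤ J T
  strict_gap : ∀ T ∈ frontier (nbhd S L), J S + eps * m ≤ J T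

/-- Essential dependence: `inf_{Sym²_+} J ≤ inf_{Sym²_{≥0} ∖ Sym²_+} J - 2 eps m`. -/
def EssentialDependence (J : Sym2Dual V → ℝ) (m eps : ℝ) : Prop :=
  sInf (J '' symPos V) ≤ sInf (J '' (symNonneg V \ symPos V)) - 2 * eps * m

/-- `β = sup_{|ω| = 1} 𝔼[|⟨X, ω⟩|⁴]^{1/2}`. -/
def fourthMomentSup (P : Measure Ω) (X : Ω → V) : ℝ≥0∞ :=
  ⨆ (w : V) (_ : ‖w‖ = 1), (∫⁻ a, ‖⟪X a, w⟫‖ₑ ^ 4 ∂P) ^ (1 / 2 : ℝ)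

/-- Along every unit direction the marginal law of `X` has a density bounded by `p0`. -/
def MarginalDensityBound (P : Measure Ω) (X : Ω → V) (p0 : ℝ) : Prop :=
  ∀ w : V, ‖w‖ = 1 → ∃ rho : ℝ → ℝ≥0∞, Measurable rho ∧
    P.map (fun a => ⟪X a, w⟫) = volume.withDensity rho ∧
    ∀ᵐ s, rho s ≤ ENNReal.ofReal p0

end Functional

/-! ### The radial profile -/

/-- `𝒦(r) = ∫ e^{-tr} dν(t)` for `r ≥ 0`. -/
def IsGaussianMixture (K : ℝ → ℝ) (ν : Measure ℝ≥0) : Prop :=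
  ∀ r, 0 ≤ r → K r = ∫ t : ℝ≥0, Real.exp (-(t : ℝ) * r) ∂ν

/-- `C_𝒦 = ∬ (π / (t + s))^{1/2} dν(t) dν(s)`, with `π / 0 = ∞`. -/
def mixtureConst (ν : Measure ℝ≥0) : ℝ≥0∞ :=
  ∫⁻ t, ∫⁻ s, (ENNReal.ofReal Real.pi / ((t + s : ℝ≥0) : ℝ≥0∞)) ^ (1 / 2 : ℝ) ∂ν ∂ν

/-- The derivative of `K` on `[0, ∞)`, one-sided at `0`. -/
def profileDeriv (K : ℝ → ℝ) (r : ℝ) : ℝ := derivWithin K (Ici 0) r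

/-- `K` is differentiable on `[0, ∞)` and its derivative is a bounded continuous function. -/
def HasBoundedContinuousDeriv (K : ℝ → ℝ) : Prop :=
  DifferentiableOn ℝ K (Ici 0) ∧ ContinuousOn (profileDeriv K) (Ici 0) ∧
    BddAbove ((fun r => |profileDeriv K r|) '' Ici 0)

/-- `‖𝒦'‖_{C⁰}`, the supremum of `|𝒦'|` over `[0, ∞)`. -/
def derivSupNorm (K : ℝ → ℝ) : ℝ := sSup ((fun r => |profileDeriv K r|) '' Ici 0)

end KernelLearning

end

open KernelLearning

/-!
Minimizing over `f` first is kernel ridge regression, and its Lagrange dual gives `𝒥(S) = max_φ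
(Re ⟨φ, Y⟩ - ½ ‖φ‖² - (2 lam)⁻¹ ∬ 𝒦(|X - X'|²_S) conj(φ) φ')` over `φ ∈ L²(P)`, with a maximizer
satisfying `‖φ‖ ≤ ‖Y‖` (`dualValue_le_formLoss`, `exists_formLoss_le_dualValue`). Since the form
`S` enters only through the kernel, every lower bound for `𝒥(S)` comes from a test function `φ`.
Write `m = 𝔼|Y|²`, and let `D` be the infimum of `𝒥` over degenerate forms; `D ≤ ½ m`, by `f = 0`.

* A form that is small in some direction is almost degenerate (`exists_degenerate_formLoss_le`).
  With `t` the minimum of `S` on the unit sphere, attained at `e`, the form `S - t ⟪e, ·⟫²` is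
  degenerate. Testing `S` with the dual optimum of that form costs at most `(2 lam)⁻¹ ‖𝒦'‖ t 𝔼[⟪e,
  X - X'⟫² |φ| |φ'|] ≤ lam⁻¹ β ‖𝒦'‖ t m`, so `D ≤ 𝒥(S) + 2 (L S(x, x)) eps m` for every unit
  vector `x`.
* A form that is large in some direction is almost useless (`half_sub_mul_le_formLoss`). Testing
  with `φ = Y` costs `(2 lam)⁻¹ m` times the Hilbert–Schmidt norm of the kernel. Complete
  monotonicity reduces the latter to a Gaussian integral along one direction, where the law of `X`
  has density at most `p0`. The result is `𝒥(S) ≥ (½ - eps) m` as soon as `S(x, x) ≥ L / 16`.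

A minimizing value `v` satisfies `v ≤ D - 2 eps m` by essential dependence. At a point at infinity
the second estimate would force `v ≥ (½ - eps) m`, a contradiction, so the vacuum is a form `S`;
the two estimates then give `1 / L ≤ S(x, x) < L / 16` on the unit sphere. A form `T` on the
boundary of `𝒩(S, L²)` satisfies in some direction either `T(x, x) = L² S(x, x) ≥ L` or `T(x, x) =
L⁻² S(x, x) < 1 / (16 L)`, and the two estimates give the gap. In the second case the first
estimate loses a factor `2` against the constant in `L`; the factor `16` in the upper bound for
`S` makes up for it.
-/

namespace KernelLearning

open scoped ComplexConjugate

/-! ### Symmetric forms -/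

section FormLemmas

variable {V : Type*} [NormedAddCommGroup V] [InnerProductSpace ℝ V]

lemma formSq_coe_smul (c : ℝ) (S : Sym2Dual V) (x : V) : formSq (c • S) x = c * formSq S x := by
  simp [formSq]

lemma formSq_smul_arg (S : Sym2Dual V) (c : ℝ) (x : V) : formSq S (c • x) = c ^ 2 * formSq S x := by
  simp [formSq]; ring

lemma formSq_ambientForm (x : V) : formSq (ambientForm V) x = ‖x‖ ^ 2 := by
  exact real_inner_self_eq_norm_sq x

lemma formSq_eq_norm_sq_mul (S : Sym2Dual V) (x : V) :
    formSq S x = ‖x‖ ^ 2 * formSq S (‖x‖⁻¹ • x) := by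
  rcases eq_or_ne x 0 with rfl | hx
  · simp [formSq]
  · have : ‖x‖ ≠ 0 := norm_ne_zero_iff.2 hx
    rw [formSq_smul_arg]; field_simp

lemma norm_inv_norm_smul {x : V} (hx : x ≠ 0) : ‖‖x‖⁻¹ • x‖ = 1 := by
  have : ‖x‖ ≠ 0 := norm_ne_zero_iff.2 hx
  rw [norm_smul, norm_inv, norm_norm, inv_mul_cancel₀ this]

lemma continuous_formSq (S : Sym2Dual V) : Continuous (formSq S) := by
  unfold formSq; fun_prop

lemma continuous_formSq_left (x : V) : Continuous fun S : Sym2Dual V => formSq S x := by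
  unfold formSq
  exact ((continuous_subtype_val.clm_apply continuous_const).clm_apply continuous_const)

lemma abs_formSq_sub_formSq_le (S T : Sym2Dual V) (x : V) :
    |formSq S x - formSq T x| ≤ dist S T * ‖x‖ ^ 2 := by
  have := (S.1 - T.1).le_opNorm₂ x x
  have hd : dist S T = ‖S.1 - T.1‖ := dist_eq_norm S.1 T.1
  rw [Real.norm_eq_abs, ← hd, mul_assoc, ← sq] at this
  exact this

lemma symPos_subset_symNonneg : symPos V ⊆ symNonneg V := by
  intro S hS x
  rcases eq_or_ne x 0 with rfl | hx
  · simp [formSq]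
  · exact (hS x hx).le

variable [FiniteDimensional ℝ V]

/-- A positive semi-definite form is a Gram form: take the square root of its operator in an
orthonormal eigenbasis. -/
lemma exists_isGramOf {S : Sym2Dual V} (hS : S ∈ symNonneg V) :
    ∃ U : V →L[ℝ] V, IsGramOf S U := by
  let T : V →ₗ[ℝ] V :=
    (InnerProductSpace.toDual ℝ V).symm.toLinearEquiv.toLinearMap ∘ₗ
      (S : V →L[ℝ] V →L[ℝ] ℝ).toLinearMap
  have hT : ∀ x y, ⟪T x, y⟫ = (S : V →L[ℝ] V →L[ℝ] ℝ) x y := fun x y => by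
    simp [T, InnerProductSpace.toDual_symm_apply]
  have hsym : T.IsSymmetric := fun x y => by
    rw [hT, real_inner_comm, hT]; exact S.2 x y
  set b := hsym.eigenvectorBasis rfl with hb
  set l := hsym.eigenvalues rfl with hl
  have hTb : ∀ i, T (b i) = l i • b i := fun i => hsym.apply_eigenvectorBasis rfl i
  have hl0 : ∀ i, 0 ≤ l i := fun i => by
    have h1 := hS (b i)
    have h2 : formSq S (b i) = l i := by
      unfold formSq
      rw [← hT, hTb, real_inner_smul_left, real_inner_self_eq_norm_sq, b.norm_eq_one]; simp
    rwa [h2] at h1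
  refine ⟨∑ i, √(l i) • (innerSL ℝ (b i)).smulRight (b i), fun x y => ?_⟩
  have hU : ∀ z, (∑ i, √(l i) • (innerSL ℝ (b i)).smulRight (b i) : V →L[ℝ] V) z
      = ∑ i, (√(l i) * ⟪b i, z⟫) • b i := fun z => by
    simp [smul_smul]
  rw [hU, hU, b.orthonormal.inner_sum, ← hT, ← b.sum_inner_mul_inner (T x) y]
  refine Finset.sum_congr rfl fun i _ => ?_
  have h3 : ⟪T x, b i⟫ = l i * ⟪b i, x⟫ := by
    rw [hsym x (b i), hTb, real_inner_smul_right, real_inner_comm]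
  have h4 := Real.mul_self_sqrt (hl0 i)
  rw [h3]
  simp only [conj_trivial]
  linear_combination -(⟪b i, x⟫ * ⟪b i, y⟫ * h4)

omit [FiniteDimensional ℝ V] in
lemma IsGramOf.formSq_eq {S : Sym2Dual V} {U : V →L[ℝ] V} (h : IsGramOf S U) (x : V) :
    formSq S x = ‖U x‖ ^ 2 := by
  unfold formSq; rw [h, real_inner_self_eq_norm_sq]

/-- A semi-definite form which is at least `r` at a unit vector dominates `r ⟪e, ·⟫²` for some unit
vector `e`. -/
lemma exists_unit_mul_inner_sq_le_formSq {S : Sym2Dual V} (hS : S ∈ symNonneg V) {x : V}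
    (hx : ‖x‖ = 1) (hr : 0 < formSq S x) :
    ∃ e : V, ‖e‖ = 1 ∧ ∀ z, formSq S x * ⟪e, z⟫ ^ 2 ≤ formSq S z := by
  obtain ⟨U, hU⟩ := exists_isGramOf hS
  set r := formSq S x
  let w : V := (InnerProductSpace.toDual ℝ V).symm ((S : V →L[ℝ] V →L[ℝ] ℝ) x)
  have hw : ∀ z, ⟪w, z⟫ = ⟪U x, U z⟫ := fun z => by
    rw [InnerProductSpace.toDual_symm_apply, hU]
  have hrU : r = ‖U x‖ ^ 2 := hU.formSq_eq x
  have hwr : r ≤ ‖w‖ := by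
    have h1 : ⟪w, x⟫ = r := by rw [hw, real_inner_self_eq_norm_sq, hrU]
    have := real_inner_le_norm w x
    rwa [h1, hx, mul_one] at this
  have hw0 : w ≠ 0 := norm_pos_iff.1 (hr.trans_le hwr)
  refine ⟨‖w‖⁻¹ • w, norm_inv_norm_smul hw0, fun z => ?_⟩
  have h2 : ⟪w, z⟫ ^ 2 ≤ r * formSq S z := by
    rw [hw, hrU, hU.formSq_eq, ← mul_pow, ← sq_abs]
    exact pow_le_pow_left₀ (abs_nonneg _) (abs_real_inner_le_norm _ _) 2
  have hwp : 0 < ‖w‖ := hr.trans_le hwr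
  rw [real_inner_smul_left, mul_pow, inv_pow]
  have h3 : r ^ 2 ≤ ‖w‖ ^ 2 := by gcongr
  have h4 : r * ((‖w‖ ^ 2)⁻¹ * ⟪w, z⟫ ^ 2) ≤ r * ((r ^ 2)⁻¹ * (r * formSq S z)) := by gcongr
  refine h4.trans_eq ?_
  field_simp

/-- A semi-definite form becomes degenerate after subtracting `t ⟪e, ·⟫²`, where `t` is its minimum
on the unit sphere, attained at `e`. -/
lemma exists_degenerate_add_rankOneForm {S : Sym2Dual V} (hS : S ∈ symNonneg V) {x : V}
    (hx : ‖x‖ = 1) :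
    ∃ (e : V) (t : ℝ) (T : Sym2Dual V), ‖e‖ = 1 ∧ 0 ≤ t ∧ t ≤ formSq S x ∧
      T ∈ symNonneg V \ symPos V ∧ ∀ z, formSq S z = formSq T z + t * ⟪e, z⟫ ^ 2 := by
  obtain ⟨e, he, hmin⟩ := (isCompact_sphere (0 : V) 1).exists_isMinOn ⟨x, by simpa using hx⟩
    (continuous_formSq S).continuousOn
  have he1 : ‖e‖ = 1 := by simpa using he
  let T : Sym2Dual V := ⟨S.1 - formSq S e • (innerSL ℝ e).smulRight (innerSL ℝ e), fun x y => by
    simp [S.2 x y, mul_comm]⟩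
  have hval : ∀ z, formSq T z = formSq S z - formSq S e * ⟪e, z⟫ ^ 2 := fun z => by
    simp [formSq, T, sq]
  refine ⟨e, formSq S e, T, he1, hS e,
    hmin (by simpa using hx), ⟨fun z => ?_, fun h => ?_⟩, fun z => ?_⟩
  · rw [hval]
    have h1 : formSq S e * ‖z‖ ^ 2 ≤ formSq S z := by
      rcases eq_or_ne z 0 with rfl | hz
      · simp [formSq]
      · rw [formSq_eq_norm_sq_mul S z, mul_comm]
        have := hmin (show ‖z‖⁻¹ • z ∈ Metric.sphere (0 : V) 1 by
          simpa using norm_inv_norm_smul hz)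
        gcongr
        exact this
    have h2 : ⟪e, z⟫ ^ 2 ≤ ‖z‖ ^ 2 := by
      rw [← sq_abs]
      have := abs_real_inner_le_norm e z
      rw [he1, one_mul] at this
      gcongr
    have := mul_le_mul_of_nonneg_left h2 (hS e)
    linarith
  · have h0 : e ≠ 0 := by rintro rfl; simp at he1
    have := h e h0
    rw [hval, real_inner_self_eq_norm_sq, he1] at this
    simp at this
  · rw [hval]; ring

/-- If one form is strictly below another off the origin, then the order persists for all nearby
forms, by compactness of the unit sphere. -/
lemma eventually_formLE_of_forall_lt {A B : Sym2Dual V}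
    (h : ∀ x, ‖x‖ = 1 → formSq A x < formSq B x) :
    ∃ d > 0, ∀ A' B' : Sym2Dual V, dist A' A < d → dist B' B < d → FormLE A' B' := by
  set D : V → ℝ := fun x => formSq B x - formSq A x with hD
  have hDhom : ∀ x, D x = ‖x‖ ^ 2 * D (‖x‖⁻¹ • x) := fun x => by
    simp only [hD]
    rw [formSq_eq_norm_sq_mul B x, formSq_eq_norm_sq_mul A x]; ring
  obtain hemp | ⟨x0, hx0⟩ := (Metric.sphere (0 : V) 1).eq_empty_or_nonempty
  · refine ⟨1, one_pos, fun A' B' _ _ x => ?_⟩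
    rcases eq_or_ne x 0 with rfl | hx
    · simp [formSq]
    · have : ‖x‖⁻¹ • x ∈ Metric.sphere (0 : V) 1 := by simpa using norm_inv_norm_smul hx
      rw [hemp] at this; exact this.elim
  obtain ⟨e, he, hmin⟩ := (isCompact_sphere (0 : V) 1).exists_isMinOn ⟨x0, hx0⟩
    ((continuous_formSq B).sub (continuous_formSq A)).continuousOn
  have hpos : 0 < D e := by
    exact sub_pos.2 (h e (by simpa using he))
  refine ⟨D e / 2, by positivity, fun A' B' hA hB x => ?_⟩
  have h1 : D e * ‖x‖ ^ 2 ≤ D x := by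
    rcases eq_or_ne x 0 with rfl | hz
    · simp [hD, formSq]
    · rw [hDhom x, mul_comm]
      have := hmin (show ‖x‖⁻¹ • x ∈ Metric.sphere (0 : V) 1 by
        simpa using norm_inv_norm_smul hz)
      gcongr
      exact this
  have h2 := (abs_le.1 (abs_formSq_sub_formSq_le A' A x)).2
  have h3 := (abs_le.1 (abs_formSq_sub_formSq_le B' B x)).1
  have h4 := mul_le_mul_of_nonneg_right hA.le (sq_nonneg ‖x‖)
  have h5 := mul_le_mul_of_nonneg_right hB.le (sq_nonneg ‖x‖)
  have h6 : D x = formSq B x - formSq A x := rfl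
  linarith

/-- A form on the boundary of `𝒩(S, L)` touches one of the two bounds in some direction. -/
lemma exists_eq_of_mem_frontier_nbhd {S T : Sym2Dual V} (hS : S ∈ symPos V) {L : ℝ} (hL : 0 < L)
    (hT : T ∈ frontier (nbhd S L)) :
    T ∈ symNonneg V ∧ ∃ x, ‖x‖ = 1 ∧
      (formSq T x = L⁻¹ * formSq S x ∨ formSq T x = L * formSq S x) := by
  have hnb : nbhd S L = {T | FormLE (L⁻¹ • S) T ∧ FormLE T (L • S)} := by
    ext T
    refine ⟨fun h => h.2, fun h => ⟨fun x hx => ?_, h⟩⟩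
    refine lt_of_lt_of_le ?_ (h.1 x)
    rw [formSq_coe_smul]
    exact mul_pos (inv_pos.2 hL) (hS x hx)
  have hclosed : IsClosed (nbhd S L) := by
    rw [hnb]
    simp only [FormLE, ofPred_and, ofPred_forall]
    refine (isClosed_iInter fun x => ?_).inter (isClosed_iInter fun x => ?_)
    · exact isClosed_le continuous_const (continuous_formSq_left x)
    · exact isClosed_le (continuous_formSq_left x) continuous_const
  have hTm : T ∈ nbhd S L := hclosed.frontier_subset hT
  refine ⟨symPos_subset_symNonneg hTm.1, ?_⟩
  by_contra! hne
  apply hT.2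
  rw [mem_interior_iff_mem_nhds]
  have h1 : ∀ x, ‖x‖ = 1 → formSq (L⁻¹ • S) x < formSq T x := fun x hx =>
    lt_of_le_of_ne (hTm.2.1 x) (by rw [formSq_coe_smul]; exact (hne x hx).1.symm)
  have h2 : ∀ x, ‖x‖ = 1 → formSq T x < formSq (L • S) x := fun x hx =>
    lt_of_le_of_ne (hTm.2.2 x) (by rw [formSq_coe_smul]; exact (hne x hx).2)
  obtain ⟨d1, hd1, H1⟩ := eventually_formLE_of_forall_lt h1
  obtain ⟨d2, hd2, H2⟩ := eventually_formLE_of_forall_lt h2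
  filter_upwards [Metric.ball_mem_nhds T hd1, Metric.ball_mem_nhds T hd2] with T' hT1 hT2
  rw [Metric.mem_ball] at hT1 hT2
  rw [hnb]
  exact ⟨H1 _ _ (by simpa using hd1) hT1, H2 _ _ hT2 (by simpa using hd2)⟩

/-- Every point at infinity is a limit of inner products: approximate `(W, S_W)` by
`S_W + (n+1)⁻¹ |·|²` on `W` and `(n+1)² |·|²` on `Wᗮ`. -/
lemma exists_tendstoInfinity (W : Submodule ℝ V) {SW : Sym2Dual W} (hSW : SW ∈ symNonneg W) :
    ∃ S : ℕ → Sym2Dual V, TendstoInfinity S W SW := by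
  let p : V →L[ℝ] W := W.orthogonalProjectionOnto
  let q : V →L[ℝ] Wᗮ := Wᗮ.orthogonalProjectionOnto
  let B : ℕ → V →L[ℝ] V →L[ℝ] ℝ := fun n =>
    ((SW : W →L[ℝ] W →L[ℝ] ℝ).bilinearComp p p)
      + ((n : ℝ) + 1)⁻¹ • ((ambientForm W).1.bilinearComp p p)
      + ((n : ℝ) + 1) ^ 2 • ((ambientForm Wᗮ).1.bilinearComp q q)
  have hB : ∀ n x y, B n x y = (SW : W →L[ℝ] W →L[ℝ] ℝ) (p x) (p y)
      + ((n : ℝ) + 1)⁻¹ * ⟪p x, p y⟫ + ((n : ℝ) + 1) ^ 2 * ⟪q x, q y⟫ := fun n x y => by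
    simp only [B, add_apply, smul_apply, ContinuousLinearMap.bilinearComp_apply, smul_eq_mul]
    rfl
  have hS : ∀ n x, B n x x = formSq SW (p x) + ((n : ℝ) + 1)⁻¹ * ‖p x‖ ^ 2
      + ((n : ℝ) + 1) ^ 2 * ‖q x‖ ^ 2 := fun n x => by
    rw [hB, real_inner_self_eq_norm_sq, real_inner_self_eq_norm_sq]; rfl
  refine ⟨fun n => ⟨B n, fun x y => ?_⟩, fun n x hx => ?_, fun x y => ?_,
    fun n => (n : ℝ) + 1, tendsto_atTop_add_const_right _ _ tendsto_natCast_atTop_atTop,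
    fun n x hx y hy => ?_⟩
  · rw [hB, hB, SW.2, real_inner_comm, real_inner_comm (q x)]
  · change 0 < B n x x
    rw [hS]
    have hpos : 0 < ‖p x‖ ^ 2 + ‖q x‖ ^ 2 := by
      have hxpq : (p x : V) + (q x : V) = x := W.starProjection_add_starProjection_orthogonal x
      by_contra! hcon
      have h1 : p x = 0 := norm_eq_zero.1 (by nlinarith [sq_nonneg ‖p x‖, sq_nonneg ‖q x‖])
      have h2 : q x = 0 := norm_eq_zero.1 (by nlinarith [sq_nonneg ‖p x‖, sq_nonneg ‖q x‖])
      rw [h1, h2] at hxpq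
      exact hx (by simpa using hxpq.symm)
    have h0 := hSW (p x)
    rcases (sq_nonneg ‖p x‖).eq_or_lt with h | h
    · rw [← h] at hpos ⊢
      have : 0 < ((n : ℝ) + 1) ^ 2 * ‖q x‖ ^ 2 := by
        rw [zero_add] at hpos; positivity
      linarith
    · positivity
  · have hp : ∀ z : W, p z = z := fun z => W.orthogonalProjectionOnto_mem_subspace_eq_self z
    have hq : ∀ z : W, q z = 0 := fun z =>
      Submodule.orthogonalProjectionOnto_orthogonal_apply_eq_zero z.2
    have : (fun n => B n x y) = fun n : ℕ => (SW : W →L[ℝ] W →L[ℝ] ℝ) x y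
        + ((n : ℝ) + 1)⁻¹ * ⟪x, y⟫ := by
      ext n; rw [hB, hp, hp, hq, hq]; simp
    change Tendsto (fun n => B n x y) _ _
    rw [this]
    have h := (tendsto_one_div_add_atTop_nhds_zero_nat (𝕜 := ℝ)).mul_const ⟪x, y⟫
    simpa [one_div] using h.const_add ((SW : W →L[ℝ] W →L[ℝ] ℝ) x y)
  · change _ ≤ B n (x + y) (x + y)
    have hq : q (x + y) = ⟨x, hx⟩ := by
      rw [map_add]
      have h1 : q x = ⟨x, hx⟩ := Wᗮ.orthogonalProjectionOnto_mem_subspace_eq_self ⟨x, hx⟩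
      have h2 : q y = 0 := Submodule.orthogonalProjectionOnto_orthogonal_apply_eq_zero hy
      rw [h1, h2, add_zero]
    rw [hS, hq]
    have h0 := hSW (p (x + y))
    have h1 : 0 ≤ ((n : ℝ) + 1)⁻¹ * ‖p (x + y)‖ ^ 2 := by positivity
    have : ‖(⟨x, hx⟩ : Wᗮ)‖ = ‖x‖ := rfl
    rw [this]
    linarith

end FormLemmas

/-! ### Regularized equations with a bounded kernel -/

section KernelOperators

variable {Ω : Type*} [MeasurableSpace Ω]

/-- The Hermitian form `∬ κ(a, a') conj(φ(a)) φ(a') dP dP` of a real kernel `κ`, or rather its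
real part, to which it is equal when `κ` is symmetric. -/
noncomputable def kernelForm (P : Measure Ω) (κ : Ω × Ω → ℝ) (φ : Ω → ℂ) : ℝ :=
  ∫ p, κ p * (conj (φ p.1) * φ p.2).re ∂(P.prod P)

/-- The dual functional `Re ⟨φ, Y⟩ - ½ ‖φ‖² - (2 lam)⁻¹ ⟨φ, κ φ⟩` of kernel ridge regression. -/
noncomputable def dualValue (P : Measure Ω) (κ : Ω × Ω → ℝ) (Y : Ω → ℂ) (lam : ℝ) (φ : Ω → ℂ) : ℝ :=
  ∫ a, (conj (φ a) * Y a).re ∂P - 1 / 2 * ∫ a, ‖φ a‖ ^ 2 ∂P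
    - 1 / (2 * lam) * kernelForm P κ φ

variable {P : Measure Ω}

lemma integrable_conj_mul {φ ψ : Ω → ℂ} (hφ : MemLp φ 2 P) (hψ : MemLp ψ 2 P) :
    Integrable (fun a => conj (φ a) * ψ a) P :=
  hφ.star.integrable_mul hψ

lemma integrable_norm_sq {φ : Ω → ℂ} (hφ : MemLp φ 2 P) : Integrable (fun a => ‖φ a‖ ^ 2) P :=
  hφ.integrable_norm_pow two_ne_zero

lemma re_conj_mul_le (z w : ℂ) : (conj z * w).re ≤ 1 / 2 * ‖z‖ ^ 2 + 1 / 2 * ‖w‖ ^ 2 := by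
  have h1 := Complex.re_le_norm (conj z * w)
  rw [norm_mul, RCLike.norm_conj] at h1
  nlinarith [sq_nonneg (‖z‖ - ‖w‖)]

lemma integrable_kernel_mul [SFinite P] {κ : Ω × Ω → ℝ} (hκ : Measurable κ) (hκ1 : ∀ p, |κ p| ≤ 1)
    {φ ψ : Ω → ℂ} (hφ : Integrable φ P) (hψ : Integrable ψ P) :
    Integrable (fun p : Ω × Ω => (κ p : ℂ) * (conj (φ p.1) * ψ p.2)) (P.prod P) := by
  have hc : Integrable (fun a => conj (φ a)) P :=
    hφ.norm.mono (Complex.continuous_conj.comp_aestronglyMeasurable hφ.1)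
      (Eventually.of_forall fun a => by simp)
  exact (hc.mul_prod hψ).bdd_mul (c := 1)
    (Complex.measurable_ofReal.comp hκ).aestronglyMeasurable
    (Eventually.of_forall fun p => by simpa using hκ1 p)

variable [IsProbabilityMeasure P]

lemma kernelForm_eq_re_integral_integral {κ : Ω × Ω → ℝ} (hκ : Measurable κ)
    (hκ1 : ∀ p, |κ p| ≤ 1) {φ : Ω → ℂ} (hφ : Integrable φ P) :
    kernelForm P κ φ = (∫ a, conj (φ a) * ∫ a', (κ (a, a') : ℂ) * φ a' ∂P ∂P).re := by
  have hint := integrable_kernel_mul hκ hκ1 hφ hφ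
  have h1 : kernelForm P κ φ
      = (∫ p : Ω × Ω, (κ p : ℂ) * (conj (φ p.1) * φ p.2) ∂(P.prod P)).re := by
    rw [← Complex.reCLM_apply, ← ContinuousLinearMap.integral_comp_comm _ hint]
    unfold kernelForm
    congr 1; ext p
    exact (Complex.re_ofReal_mul _ _).symm
  rw [h1, integral_prod _ hint]
  congr 2; ext a
  rw [← integral_const_mul]
  congr 1; ext a'
  ring

/-- The equation `φ + lam⁻¹ κ φ = Y` is solvable in `L²` for a bounded positive semi-definite
kernel: the operator `1 + lam⁻¹ κ` is coercive. -/
lemma exists_solution_of_kernelForm_nonneg {κ : Ω × Ω → ℝ} (hκ : Measurable κ)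
    (hκ1 : ∀ p, |κ p| ≤ 1) (hpos : ∀ φ : Ω → ℂ, MemLp φ 2 P → 0 ≤ kernelForm P κ φ)
    {lam : ℝ} (hlam : 0 < lam) {Y : Ω → ℂ} (hY : MemLp Y 2 P) :
    ∃ φ : Ω → ℂ, MemLp φ 2 P ∧
      ∀ᵐ a ∂P, φ a + (lam⁻¹ : ℂ) * ∫ a', (κ (a, a') : ℂ) * φ a' ∂P = Y a := by
  have hκm : Measurable fun p => (κ p : ℂ) := Complex.measurable_ofReal.comp hκ
  have hint : ∀ (φ : Lp ℂ 2 P) a, Integrable (fun a' => (κ (a, a') : ℂ) * φ a') P := fun φ a =>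
    ((Lp.memLp φ).integrable one_le_two).bdd_mul (c := 1)
      (hκm.comp measurable_prodMk_left).aestronglyMeasurable
      (Eventually.of_forall fun p => by simpa using hκ1 _)
  have hbd : ∀ (φ : Lp ℂ 2 P) a, ‖∫ a', (κ (a, a') : ℂ) * φ a' ∂P‖ ≤ ‖φ‖ := fun φ a => by
    have h1 : ‖∫ a', (κ (a, a') : ℂ) * φ a' ∂P‖ ≤ ∫ a', ‖φ a'‖ ∂P := by
      refine (norm_integral_le_integral_norm _).trans
        (integral_mono (hint φ a).norm ((Lp.memLp φ).integrable one_le_two).norm fun a' => ?_)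
      simp only [norm_mul, Complex.norm_real, Real.norm_eq_abs]
      exact mul_le_of_le_one_left (norm_nonneg _) (hκ1 _)
    refine h1.trans ?_
    rw [Lp.norm_def, integral_norm_eq_lintegral_enorm (Lp.memLp φ).1,
      ← eLpNorm_one_eq_lintegral_enorm]
    exact ENNReal.toReal_mono (Lp.eLpNorm_ne_top φ)
      (eLpNorm_le_eLpNorm_of_exponent_le one_le_two (Lp.memLp φ).1)
  have hmem : ∀ φ : Lp ℂ 2 P, MemLp (fun a => ∫ a', (κ (a, a') : ℂ) * φ a' ∂P) 2 P := fun φ => by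
    refine MemLp.of_bound ?_ ‖φ‖ (Eventually.of_forall (hbd φ))
    have h : AEStronglyMeasurable (fun p : Ω × Ω => (κ p : ℂ) * φ p.2) (P.prod P) :=
      hκm.aestronglyMeasurable.mul (Lp.memLp φ).1.comp_snd
    exact h.integral_prod_right'
  let T₀ : Lp ℂ 2 P →ₗ[ℂ] Lp ℂ 2 P :=
    { toFun := fun φ => (hmem φ).toLp _
      map_add' := fun φ ψ => by
        rw [← MemLp.toLp_add]
        refine MemLp.toLp_congr _ _ (Eventually.of_forall fun a => ?_)
        simp only [Pi.add_apply]
        rw [← integral_add (hint φ a) (hint ψ a)]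
        refine integral_congr_ae ?_
        filter_upwards [Lp.coeFn_add φ ψ] with a' h
        rw [h, Pi.add_apply, mul_add]
      map_smul' := fun c φ => by
        rw [RingHom.id_apply, ← MemLp.toLp_const_smul]
        refine MemLp.toLp_congr _ _ (Eventually.of_forall fun a => ?_)
        simp only [Pi.smul_apply]
        rw [← integral_smul]
        refine integral_congr_ae ?_
        filter_upwards [Lp.coeFn_smul c φ] with a' h
        rw [h, Pi.smul_apply, smul_eq_mul, smul_eq_mul]; ring }
  have hT₀ : ∀ φ : Lp ℂ 2 P, T₀ φ =ᵐ[P] fun a => ∫ a', (κ (a, a') : ℂ) * φ a' ∂P := fun φ =>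
    (hmem φ).coeFn_toLp
  let T : Lp ℂ 2 P →L[ℂ] Lp ℂ 2 P := T₀.mkContinuous 1 fun φ => by
    have h := Lp.norm_le_of_ae_bound (f := T₀ φ) (C := ‖φ‖) (norm_nonneg _) (by
      filter_upwards [hT₀ φ] with a ha
      rw [ha]; exact hbd φ a)
    simpa [measureUnivNNReal] using h
  have hinner : ∀ φ : Lp ℂ 2 P, (inner ℂ φ (T φ)).re = kernelForm P κ φ := fun φ => by
    rw [kernelForm_eq_re_integral_integral hκ hκ1 ((Lp.memLp φ).integrable one_le_two),
      L2.inner_def]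
    congr 1
    refine integral_congr_ae ?_
    filter_upwards [hT₀ φ] with a ha
    rw [RCLike.inner_apply]
    change T₀ φ a * _ = _
    rw [ha, mul_comm]
  have hunit : IsUnit (1 + (lam⁻¹ : ℂ) • T) := by
    refine ContinuousLinearMap.isUnit_of_forall_le_norm_inner_map _ (c := 1) one_pos fun φ => ?_
    refine le_trans ?_ (Complex.re_le_norm _)
    have h1 : (inner ℂ ((1 + (lam⁻¹ : ℂ) • T) φ) φ).re
        = ‖φ‖ ^ 2 + lam⁻¹ * kernelForm P κ φ := by
      have h2 : (inner ℂ φ φ).re = ‖φ‖ ^ 2 := inner_self_eq_norm_sq (𝕜 := ℂ) φ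
      have h3 : (inner ℂ (T φ) φ).re = (inner ℂ φ (T φ)).re := inner_re_symm (𝕜 := ℂ) _ _
      have h4 : (1 + (lam⁻¹ : ℂ) • T) φ = φ + ((lam⁻¹ : ℝ) : ℂ) • T φ := by simp
      rw [h4, inner_add_left, inner_smul_left, Complex.conj_ofReal, Complex.add_re,
        Complex.re_ofReal_mul, h2, h3, hinner]
    rw [h1]
    have := mul_nonneg (inv_nonneg.2 hlam.le) (hpos φ (Lp.memLp φ))
    simpa using this
  obtain ⟨φ, hφ⟩ := (ContinuousLinearMap.isUnit_iff_bijective.1 hunit).2 (hY.toLp Y)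
  refine ⟨φ, Lp.memLp φ, ?_⟩
  have h5 : φ + (lam⁻¹ : ℂ) • T₀ φ = hY.toLp Y := by rw [← hφ]; simp [T]
  have h6 := Lp.coeFn_add φ ((lam⁻¹ : ℂ) • T₀ φ)
  have h7 := Lp.coeFn_smul (lam⁻¹ : ℂ) (T₀ φ)
  rw [h5] at h6
  filter_upwards [h6, h7, hT₀ φ, hY.coeFn_toLp] with a h6 h7 h8 h9
  rw [← h9, h6, Pi.add_apply, h7, Pi.smul_apply, h8, smul_eq_mul]

/-- A solution of `φ + lam⁻¹ κ φ = Y` tested against itself. -/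
lemma integral_re_conj_mul_of_solution {κ : Ω × Ω → ℝ} (hκ : Measurable κ)
    (hκ1 : ∀ p, |κ p| ≤ 1) {lam : ℝ} {Y φ : Ω → ℂ} (hφ : MemLp φ 2 P)
    (h : ∀ᵐ a ∂P, φ a + (lam⁻¹ : ℂ) * ∫ a', (κ (a, a') : ℂ) * φ a' ∂P = Y a) :
    ∫ a, (conj (φ a) * Y a).re ∂P = ∫ a, ‖φ a‖ ^ 2 ∂P + lam⁻¹ * kernelForm P κ φ := by
  have hφ1 := hφ.integrable one_le_two
  have hint : Integrable (fun a => conj (φ a) * ∫ a', (κ (a, a') : ℂ) * φ a' ∂P) P := by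
    have := (integrable_kernel_mul hκ hκ1 hφ1 hφ1).integral_prod_left
    refine this.congr (Eventually.of_forall fun a => ?_)
    simp only
    rw [← integral_const_mul]
    congr 1; ext a'; ring
  have hk : kernelForm P κ φ = ∫ a, (conj (φ a) * ∫ a', (κ (a, a') : ℂ) * φ a' ∂P).re ∂P := by
    rw [kernelForm_eq_re_integral_integral hκ hκ1 hφ1]
    exact (integral_re hint).symm
  have hre : Integrable (fun a => (conj (φ a) * ∫ a', (κ (a, a') : ℂ) * φ a' ∂P).re) P := hint.re
  rw [hk, ← integral_const_mul, ← integral_add (integrable_norm_sq hφ) (hre.const_mul _)]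
  refine integral_congr_ae ?_
  filter_upwards [h] with a ha
  rw [← ha, mul_add, Complex.add_re]
  congr 1
  · rw [← Complex.normSq_eq_conj_mul_self, Complex.ofReal_re, Complex.normSq_eq_norm_sq]
  · rw [mul_left_comm, ← Complex.ofReal_inv, Complex.re_ofReal_mul]

end KernelOperators

/-! ### Duality for kernel ridge regression -/

section Duality

variable {V : Type*} [NormedAddCommGroup V] [InnerProductSpace ℝ V] [FiniteDimensional ℝ V]
  [MeasurableSpace V] [BorelSpace V] {Ω : Type*} [MeasurableSpace Ω]

lemma fourierInv_eq_integral_mul (g : V → ℂ) (x : V) :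
    𝓕⁻ g x = ∫ ω, (Real.fourierChar ⟪ω, x⟫ : ℂ) * g ω := by
  rw [Real.fourierInv_eq]; rfl

lemma conj_fourierChar (t : ℝ) :
    conj (Real.fourierChar t : ℂ) = (Real.fourierChar (-t) : ℂ) := by
  rw [AddChar.map_neg_eq_inv, Circle.coe_inv_eq_conj]

lemma continuous_fourierInv {g : V → ℂ} (hg : Integrable g) : Continuous (𝓕⁻ g) :=
  VectorFourier.fourierIntegral_continuous Real.continuous_fourierChar
    (by simp only [LinearMap.neg_apply, innerₗ_apply_apply]; fun_prop) hg

lemma norm_fourierInv_le (g : V → ℂ) (x : V) : ‖𝓕⁻ g x‖ ≤ ∫ ω, ‖g ω‖ := by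
  rw [Real.fourierInv_eq]
  exact (norm_integral_le_integral_norm _).trans_eq (by simp [Circle.norm_smul])

section Kernel

variable {kV : V → ℝ} {K : ℝ → ℝ}

lemma IsRadialKernel.abs_le_one (hK : IsRadialKernel kV K) (x : V) : |K (‖x‖ ^ 2)| ≤ 1 := by
  have h := norm_fourierInv_le (fun ω => (kV ω : ℂ)) x
  have h2 : 𝓕⁻ (fun ω => (kV ω : ℂ)) x = _ := hK.kernel_eq x
  rw [h2, Complex.norm_real, Real.norm_eq_abs] at h
  refine h.trans_eq ?_
  rw [← hK.integral_eq_one]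
  congr 1; ext ω
  simp [abs_of_pos (hK.pos ω)]

lemma IsRadialKernel.continuous_comp_norm_sq (hK : IsRadialKernel kV K) :
    Continuous fun x : V => K (‖x‖ ^ 2) := by
  have h : Continuous (fun x : V => ((K (‖x‖ ^ 2) : ℝ) : ℂ)) := by
    simp_rw [← hK.kernel_eq]
    exact continuous_fourierInv hK.integrable.ofReal
  exact Complex.continuous_re.comp h

end Kernel

variable {P : Measure Ω} [IsProbabilityMeasure P] {Z : Ω → V}

/-- The characteristic transform `ω ↦ 𝔼[φ e^{-2πi⟨ω, Z⟩}]` of the complex measure `φ P` along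
`Z`. -/
noncomputable def charTransform (P : Measure Ω) (Z : Ω → V) (φ : Ω → ℂ) (ω : V) : ℂ :=
  ∫ a, (Real.fourierChar (-⟪ω, Z a⟫) : ℂ) * φ a ∂P

lemma measurable_fourierChar_inner (hZ : Measurable Z) :
    Measurable fun p : V × Ω => (Real.fourierChar ⟪p.1, Z p.2⟫ : ℂ) := by
  have hc : Continuous fun q : V × V => (Real.fourierChar ⟪q.1, q.2⟫ : ℂ) :=
    continuous_subtype_val.comp (Real.continuous_fourierChar.comp continuous_inner)
  exact hc.measurable.comp (measurable_fst.prodMk (hZ.comp measurable_snd))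

omit [FiniteDimensional ℝ V] [MeasurableSpace V] [BorelSpace V] [IsProbabilityMeasure P] in
lemma norm_charTransform_le (φ : Ω → ℂ) (ω : V) : ‖charTransform P Z φ ω‖ ≤ ∫ a, ‖φ a‖ ∂P :=
  (norm_integral_le_integral_norm _).trans_eq (by
    congr 1; ext a; rw [norm_mul, Circle.norm_coe, one_mul])

lemma aestronglyMeasurable_charTransform (hZ : Measurable Z) {φ : Ω → ℂ} (hφ : Integrable φ P) :
    AEStronglyMeasurable (charTransform P Z φ) (volume : Measure V) := by
  have h : AEStronglyMeasurable
      (fun p : V × Ω => (Real.fourierChar (-⟪p.1, Z p.2⟫) : ℂ) * φ p.2)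
      ((volume : Measure V).prod P) := by
    simp_rw [← conj_fourierChar]
    have hm := Complex.continuous_conj.measurable.comp (measurable_fourierChar_inner hZ)
    exact hm.aestronglyMeasurable.mul hφ.1.comp_snd
  exact h.integral_prod_right'

/-- The adjointness of the inverse Fourier transform, sampled along `Z`, and `charTransform`. -/
lemma integral_conj_mul_fourierInv (hZ : Measurable Z) {φ : Ω → ℂ} (hφ : Integrable φ P)
    {g : V → ℂ} (hg : Integrable g) :
    ∫ a, conj (φ a) * 𝓕⁻ g (Z a) ∂P = ∫ ω, g ω * conj (charTransform P Z φ ω) := by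
  have hc : Integrable (fun a => conj (φ a)) P :=
    hφ.norm.mono (Complex.continuous_conj.comp_aestronglyMeasurable hφ.1)
      (Eventually.of_forall fun a => by simp)
  have hint : Integrable (fun p : V × Ω =>
      (Real.fourierChar ⟪p.1, Z p.2⟫ : ℂ) * (g p.1 * conj (φ p.2))) (volume.prod P) :=
    (hg.mul_prod hc).bdd_mul (c := 1) (measurable_fourierChar_inner hZ).aestronglyMeasurable
      (Eventually.of_forall fun p => (Circle.norm_coe _).le)
  have h1 : ∀ a, conj (φ a) * 𝓕⁻ g (Z a)
      = ∫ ω, (Real.fourierChar ⟪ω, Z a⟫ : ℂ) * (g ω * conj (φ a)) := fun a => by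
    rw [fourierInv_eq_integral_mul, ← integral_const_mul]
    congr 1; ext ω; ring
  have h2 : ∀ ω, g ω * conj (charTransform P Z φ ω)
      = ∫ a, (Real.fourierChar ⟪ω, Z a⟫ : ℂ) * (g ω * conj (φ a)) ∂P := fun ω => by
    rw [charTransform, ← integral_conj, ← integral_const_mul]
    congr 1; ext a
    rw [map_mul, conj_fourierChar, neg_neg]; ring
  simp_rw [h1, h2]
  exact (integral_integral_swap (f := fun ω a =>
    (Real.fourierChar ⟪ω, Z a⟫ : ℂ) * (g ω * conj (φ a))) hint).symm

variable {kV : V → ℝ} {K : ℝ → ℝ}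

lemma integrable_mul_charTransform (hk : Integrable kV) (hZ : Measurable Z) {φ : Ω → ℂ}
    (hφ : Integrable φ P) : Integrable fun ω => (kV ω : ℂ) * charTransform P Z φ ω :=
  hk.ofReal.mul_bdd (c := ∫ a, ‖φ a‖ ∂P) (aestronglyMeasurable_charTransform hZ hφ)
    (Eventually.of_forall fun ω => norm_charTransform_le φ ω)

/-- The function with Fourier transform `k_V · charTransform φ` is the kernel expansion
`x ↦ 𝔼[𝒦(|x - Z|²) φ]`. -/
lemma fourierInv_mul_charTransform (hK : IsRadialKernel kV K) (hZ : Measurable Z) {φ : Ω → ℂ}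
    (hφ : Integrable φ P) (x : V) :
    𝓕⁻ (fun ω => (kV ω : ℂ) * charTransform P Z φ ω) x
      = ∫ a, (K (‖x - Z a‖ ^ 2) : ℂ) * φ a ∂P := by
  have hchar : ∀ ω y z : V, (Real.fourierChar ⟪ω, y - z⟫ : ℂ)
      = (Real.fourierChar ⟪ω, y⟫ : ℂ) * (Real.fourierChar (-⟪ω, z⟫) : ℂ) := fun ω y z => by
    rw [inner_sub_right, sub_eq_add_neg, AddChar.map_add_eq_mul, Circle.coe_mul]
  have hint : Integrable (fun p : V × Ω =>
      (Real.fourierChar ⟪p.1, x - Z p.2⟫ : ℂ) * ((kV p.1 : ℂ) * φ p.2)) (volume.prod P) :=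
    ((hK.integrable.ofReal (𝕜 := ℂ)).mul_prod hφ).bdd_mul (c := 1)
      (measurable_fourierChar_inner (measurable_const.sub hZ)).aestronglyMeasurable
      (Eventually.of_forall fun p => (Circle.norm_coe _).le)
  have h1 : ∀ ω, (Real.fourierChar ⟪ω, x⟫ : ℂ) * ((kV ω : ℂ) * charTransform P Z φ ω)
      = ∫ a, (Real.fourierChar ⟪ω, x - Z a⟫ : ℂ) * ((kV ω : ℂ) * φ a) ∂P := fun ω => by
    rw [charTransform, ← integral_const_mul, ← integral_const_mul]
    congr 1; ext a
    rw [hchar]; ring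
  have h2 : ∀ a, (K (‖x - Z a‖ ^ 2) : ℂ) * φ a
      = ∫ ω, (Real.fourierChar ⟪ω, x - Z a⟫ : ℂ) * ((kV ω : ℂ) * φ a) := fun a => by
    rw [← hK.kernel_eq, kernelFn, fourierInv_eq_integral_mul, ← integral_mul_const]
    congr 1; ext ω; ring
  rw [fourierInv_eq_integral_mul]
  simp_rw [h1, h2]
  exact integral_integral_swap (f := fun ω a =>
    (Real.fourierChar ⟪ω, x - Z a⟫ : ℂ) * ((kV ω : ℂ) * φ a)) hint

lemma integrable_mul_norm_sq_charTransform (hk : Integrable kV) (hZ : Measurable Z) {φ : Ω → ℂ}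
    (hφ : Integrable φ P) : Integrable fun ω => kV ω * ‖charTransform P Z φ ω‖ ^ 2 :=
  hk.mul_bdd (c := (∫ a, ‖φ a‖ ∂P) ^ 2) ((aestronglyMeasurable_charTransform hZ hφ).norm.pow 2)
    (Eventually.of_forall fun ω => by
      rw [norm_pow, norm_norm]
      gcongr
      exact norm_charTransform_le φ ω)

lemma measurable_kernel (hK : IsRadialKernel kV K) (hZ : Measurable Z) :
    Measurable fun p : Ω × Ω => K (‖Z p.1 - Z p.2‖ ^ 2) :=
  hK.continuous_comp_norm_sq.measurable.comp
    ((hZ.comp measurable_fst).sub (hZ.comp measurable_snd))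

/-- The Hermitian form of the kernel in frequency space; in particular it is nonnegative. -/
lemma kernelForm_eq_integral_mul_norm_sq (hK : IsRadialKernel kV K) (hZ : Measurable Z) {φ : Ω → ℂ}
    (hφ : Integrable φ P) :
    kernelForm P (fun p => K (‖Z p.1 - Z p.2‖ ^ 2)) φ
      = ∫ ω, kV ω * ‖charTransform P Z φ ω‖ ^ 2 := by
  rw [kernelForm_eq_re_integral_integral (measurable_kernel hK hZ) (fun _ => hK.abs_le_one _) hφ]
  simp_rw [← fourierInv_mul_charTransform hK hZ hφ]
  rw [integral_conj_mul_fourierInv hZ hφ (integrable_mul_charTransform hK.integrable hZ hφ)]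
  have h : ∀ ω, (kV ω : ℂ) * charTransform P Z φ ω * conj (charTransform P Z φ ω)
      = ((kV ω * ‖charTransform P Z φ ω‖ ^ 2 : ℝ) : ℂ) := fun ω => by
    rw [mul_assoc, Complex.mul_conj, Complex.normSq_eq_norm_sq]; push_cast; ring
  simp_rw [h]
  rw [integral_complex_ofReal, Complex.ofReal_re]

lemma enorm_sq_div_ofReal {k : ℝ} (hk : 0 < k) (z : ℂ) :
    ‖z‖ₑ ^ 2 / ENNReal.ofReal k = ENNReal.ofReal (‖z‖ ^ 2 / k) := by
  rw [ENNReal.ofReal_div_of_pos hk, ENNReal.ofReal_pow (norm_nonneg _), ofReal_norm]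

variable {X : Ω → V} {Y : Ω → ℂ} {lam : ℝ} {U : V →L[ℝ] V}

omit [IsProbabilityMeasure P] in
lemma loss_nonneg (hlam : 0 < lam) (f : V → ℂ) : 0 ≤ loss kV P X Y lam f U := by
  unfold loss; positivity

/-- Weak duality: Young's inequality, once for the residual on `L²(P)` and once for the Fourier
transform of `f` against the weight `k_V`. -/
lemma dualValue_le_loss (hK : IsRadialKernel kV K) (hlam : 0 < lam) (hX : Measurable X)
    (hY : MemLp Y 2 P) {φ : Ω → ℂ} (hφ : MemLp φ 2 P) {f : V → ℂ} (hf : f ∈ rkhs kV) :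
    dualValue P (fun p => K (‖U (X p.1) - U (X p.2)‖ ^ 2)) Y lam φ ≤ loss kV P X Y lam f U := by
  set Z : Ω → V := fun a => U (X a)
  have hZ : Measurable Z := U.measurable.comp hX
  have hφ1 := hφ.integrable one_le_two
  set κ : Ω × Ω → ℝ := fun p => K (‖Z p.1 - Z p.2‖ ^ 2)
  change dualValue P κ Y lam φ ≤ _
  set A : ℝ := ∫ a, ‖Y a - f (Z a)‖ ^ 2 ∂P with hA
  set D := dualValue P κ Y lam φ with hD
  suffices h : ENNReal.ofReal (2 / lam * (D - 1 / 2 * A)) ≤ rkhsNormSq kV f by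
    have h2 := (ENNReal.ofReal_le_iff_le_toReal (ne_of_lt hf)).1 h
    unfold loss
    change _ ≤ 1 / 2 * A + _
    have h3 := mul_le_mul_of_nonneg_left h2 (half_pos hlam).le
    have h4 : lam / 2 * (2 / lam * (D - 1 / 2 * A)) = D - 1 / 2 * A := by field_simp
    linarith
  refine le_iInf fun g => le_iInf fun hg => le_iInf fun hfg => ?_
  simp_rw [enorm_sq_div_ofReal (hK.pos _)]
  by_cases hN : ∫⁻ ω, ENNReal.ofReal (‖g ω‖ ^ 2 / kV ω) = ∞
  · rw [hN]; exact le_top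
  have hNint : Integrable fun ω => ‖g ω‖ ^ 2 / kV ω := by
    refine ⟨((hg.1.norm.pow 2).div₀ hK.integrable.1), ?_⟩
    rw [hasFiniteIntegral_iff_ofReal (Eventually.of_forall fun ω =>
      div_nonneg (sq_nonneg _) (hK.pos ω).le)]
    exact lt_top_iff_ne_top.2 hN
  rw [← ofReal_integral_eq_lintegral_ofReal hNint (Eventually.of_forall fun ω =>
      div_nonneg (sq_nonneg _) (hK.pos ω).le)]
  refine ENNReal.ofReal_le_ofReal ?_
  have hfmem : MemLp (fun a => f (Z a)) 2 P := by
    refine MemLp.of_bound ?_ (∫ ω, ‖g ω‖) (Eventually.of_forall fun a => ?_)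
    · rw [hfg]; exact ((continuous_fourierInv hg).measurable.comp hZ).aestronglyMeasurable
    · rw [hfg]; exact norm_fourierInv_le g _
  have h1 : ∫ a, (conj (φ a) * (Y a - f (Z a))).re ∂P
      ≤ 1 / 2 * ∫ a, ‖φ a‖ ^ 2 ∂P + 1 / 2 * A := by
    rw [hA, ← integral_const_mul, ← integral_const_mul, ← integral_add]
    · exact integral_mono (integrable_conj_mul hφ (hY.sub hfmem)).re
        (((integrable_norm_sq hφ).const_mul _).add
          ((integrable_norm_sq (hY.sub hfmem)).const_mul _)) fun a => re_conj_mul_le _ _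
    · exact (integrable_norm_sq hφ).const_mul _
    · exact (integrable_norm_sq (hY.sub hfmem)).const_mul _
  have h2 : ∫ a, (conj (φ a) * (Y a - f (Z a))).re ∂P
      = ∫ a, (conj (φ a) * Y a).re ∂P - ∫ a, (conj (φ a) * f (Z a)).re ∂P := by
    rw [← integral_sub]
    · simp_rw [mul_sub, Complex.sub_re]
    · exact (integrable_conj_mul hφ hY).re
    · exact (integrable_conj_mul hφ hfmem).re
  have h3 : ∫ a, (conj (φ a) * f (Z a)).re ∂P
      ≤ lam / 2 * (∫ ω, ‖g ω‖ ^ 2 / kV ω) + 1 / (2 * lam) * kernelForm P κ φ := by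
    have e1 : ∫ a, (conj (φ a) * f (Z a)).re ∂P = (∫ a, conj (φ a) * f (Z a) ∂P).re :=
      integral_re (integrable_conj_mul hφ hfmem)
    have hgb : Integrable fun ω => g ω * conj (charTransform P Z φ ω) :=
      hg.mul_bdd (c := ∫ a, ‖φ a‖ ∂P) (Complex.continuous_conj.comp_aestronglyMeasurable
        (aestronglyMeasurable_charTransform hZ hφ1)) (Eventually.of_forall fun ω => by
          simpa using norm_charTransform_le (P := P) (Z := Z) φ ω)
    have e2 : (∫ ω, g ω * conj (charTransform P Z φ ω)).re
        = ∫ ω, (g ω * conj (charTransform P Z φ ω)).re := (integral_re hgb).symm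
    have hkb := integrable_mul_norm_sq_charTransform hK.integrable hZ hφ1
    rw [e1, hfg, integral_conj_mul_fourierInv hZ hφ1 hg, e2,
      kernelForm_eq_integral_mul_norm_sq hK hZ hφ1, ← integral_const_mul, ← integral_const_mul,
      ← integral_add (hNint.const_mul _) (hkb.const_mul _)]
    refine integral_mono hgb.re ((hNint.const_mul _).add (hkb.const_mul _)) fun ω => ?_
    have hk := hK.pos ω
    refine (Complex.re_le_norm _).trans ?_
    rw [norm_mul, RCLike.norm_conj]
    set u := ‖g ω‖
    set v := ‖charTransform P Z φ ω‖
    have : lam / 2 * (u ^ 2 / kV ω) + 1 / (2 * lam) * (kV ω * v ^ 2) - u * v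
        = (lam * u - kV ω * v) ^ 2 / (2 * lam * kV ω) := by field_simp; ring
    have h0 : 0 ≤ (lam * u - kV ω * v) ^ 2 / (2 * lam * kV ω) := by positivity
    linarith
  have hDle : D - 1 / 2 * A ≤ lam / 2 * ∫ ω, ‖g ω‖ ^ 2 / kV ω := by
    rw [hD, dualValue]; linarith
  calc 2 / lam * (D - 1 / 2 * A) ≤ 2 / lam * (lam / 2 * ∫ ω, ‖g ω‖ ^ 2 / kV ω) := by gcongr
    _ = ∫ ω, ‖g ω‖ ^ 2 / kV ω := by field_simp

lemma rkhsNormSq_zero : rkhsNormSq kV (0 : V → ℂ) = 0 := by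
  have hF : (0 : V → ℂ) = 𝓕⁻ (0 : V → ℂ) := by
    ext x; rw [fourierInv_eq_integral_mul]; simp
  refine le_antisymm ((iInf₂_le_of_le (0 : V → ℂ) (integrable_zero _ _ _)
    (iInf_le_of_le hF le_rfl)).trans_eq ?_) zero_le
  simp

lemma dualValue_le_minLoss (hK : IsRadialKernel kV K) (hlam : 0 < lam) (hX : Measurable X)
    (hY : MemLp Y 2 P) {φ : Ω → ℂ} (hφ : MemLp φ 2 P) :
    dualValue P (fun p => K (‖U (X p.1) - U (X p.2)‖ ^ 2)) Y lam φ ≤ minLoss kV P X Y lam U := by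
  have h0 : (0 : V → ℂ) ∈ rkhs kV := by
    change rkhsNormSq kV 0 < ∞
    rw [rkhsNormSq_zero]; exact ENNReal.zero_lt_top
  refine le_csInf ⟨_, mem_image_of_mem _ h0⟩ ?_
  rintro _ ⟨f, hf, rfl⟩
  exact dualValue_le_loss hK hlam hX hY hφ hf

/-- Strong duality: the residual `φ` of the minimizer solves `φ + lam⁻¹ κ φ = Y`, and the minimizer
is the kernel expansion of `lam⁻¹ φ`. -/
lemma exists_minLoss_le_dualValue (hK : IsRadialKernel kV K) (hlam : 0 < lam) (hX : Measurable X)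
    (hY : MemLp Y 2 P) :
    ∃ φ : Ω → ℂ, MemLp φ 2 P ∧ ∫ a, ‖φ a‖ ^ 2 ∂P ≤ ∫ a, ‖Y a‖ ^ 2 ∂P ∧
      minLoss kV P X Y lam U
        ≤ dualValue P (fun p => K (‖U (X p.1) - U (X p.2)‖ ^ 2)) Y lam φ := by
  set Z : Ω → V := fun a => U (X a)
  have hZ : Measurable Z := U.measurable.comp hX
  set κ : Ω × Ω → ℝ := fun p => K (‖Z p.1 - Z p.2‖ ^ 2) with hκdef
  have hκ : Measurable κ := measurable_kernel hK hZ
  have hκ1 : ∀ p, |κ p| ≤ 1 := fun p => hK.abs_le_one _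
  have hpos : ∀ φ : Ω → ℂ, MemLp φ 2 P → 0 ≤ kernelForm P κ φ := fun φ hφ => by
    rw [kernelForm_eq_integral_mul_norm_sq hK hZ (hφ.integrable one_le_two)]
    exact integral_nonneg fun ω => mul_nonneg (hK.pos ω).le (sq_nonneg _)
  obtain ⟨φ, hφ, hsol⟩ := exists_solution_of_kernelForm_nonneg hκ hκ1 hpos hlam hY
  have hφ1 := hφ.integrable one_le_two
  have htest := integral_re_conj_mul_of_solution hκ hκ1 hφ hsol
  refine ⟨φ, hφ, ?_, ?_⟩
  · have h1 : ∫ a, (conj (φ a) * Y a).re ∂P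
        ≤ 1 / 2 * ∫ a, ‖φ a‖ ^ 2 ∂P + 1 / 2 * ∫ a, ‖Y a‖ ^ 2 ∂P := by
      rw [← integral_const_mul, ← integral_const_mul, ← integral_add]
      · exact integral_mono (integrable_conj_mul hφ hY).re
          (((integrable_norm_sq hφ).const_mul _).add ((integrable_norm_sq hY).const_mul _))
          fun a => re_conj_mul_le _ _
      · exact (integrable_norm_sq hφ).const_mul _
      · exact (integrable_norm_sq hY).const_mul _
    have h2 := mul_nonneg (inv_nonneg.2 hlam.le) (hpos φ hφ)
    linarith
  · set g : V → ℂ := fun ω => (kV ω : ℂ) * charTransform P Z ((lam⁻¹ : ℂ) • φ) ω with hg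
    have hgint : Integrable g := integrable_mul_charTransform hK.integrable hZ (hφ1.smul _)
    have hb : ∀ ω, charTransform P Z ((lam⁻¹ : ℂ) • φ) ω
        = (lam⁻¹ : ℂ) * charTransform P Z φ ω := fun ω => by
      rw [charTransform, charTransform, ← integral_const_mul]
      congr 1; ext a
      rw [Pi.smul_apply, smul_eq_mul]; ring
    have hkb := integrable_mul_norm_sq_charTransform hK.integrable hZ hφ1
    have hnorm : rkhsNormSq kV (𝓕⁻ g) ≤ ENNReal.ofReal ((lam ^ 2)⁻¹ * kernelForm P κ φ) := by
      refine (iInf₂_le_of_le g hgint (iInf_le_of_le rfl le_rfl)).trans_eq ?_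
      rw [kernelForm_eq_integral_mul_norm_sq hK hZ hφ1, ← integral_const_mul,
        ofReal_integral_eq_lintegral_ofReal (hkb.const_mul _) (Eventually.of_forall fun ω =>
          mul_nonneg (by positivity) (mul_nonneg (hK.pos ω).le (sq_nonneg _)))]
      refine lintegral_congr fun ω => ?_
      rw [enorm_sq_div_ofReal (hK.pos ω)]
      congr 1
      have hk := hK.pos ω
      simp only [hg, hb, norm_mul, norm_inv, Complex.norm_real, Real.norm_eq_abs, abs_of_pos hk,
        abs_of_pos hlam]
      field_simp
    have hmem : 𝓕⁻ g ∈ rkhs kV := hnorm.trans_lt ENNReal.ofReal_lt_top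
    refine (csInf_le ⟨0, ?_⟩ (mem_image_of_mem _ hmem)).trans ?_
    · rintro _ ⟨f, -, rfl⟩; exact loss_nonneg hlam f
    have hres : ∫ a, ‖Y a - 𝓕⁻ g (Z a)‖ ^ 2 ∂P = ∫ a, ‖φ a‖ ^ 2 ∂P := by
      refine integral_congr_ae ?_
      filter_upwards [hsol] with a ha
      rw [hg, fourierInv_mul_charTransform hK hZ (hφ1.smul _), ← ha]
      congr 2
      rw [← integral_const_mul, add_sub_assoc]
      simp only [Pi.smul_apply, smul_eq_mul, hκdef, mul_left_comm, sub_self, add_zero]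
    have h3 := ENNReal.toReal_le_of_le_ofReal
      (mul_nonneg (by positivity) (hpos φ hφ)) hnorm
    unfold loss
    change 1 / 2 * ∫ a, ‖Y a - 𝓕⁻ g (Z a)‖ ^ 2 ∂P + _ ≤ _
    rw [hres, dualValue, htest]
    have h4 := mul_le_mul_of_nonneg_left h3 (half_pos hlam).le
    have h5 : lam / 2 * ((lam ^ 2)⁻¹ * kernelForm P κ φ)
        = 1 / 2 * (lam⁻¹ * kernelForm P κ φ) := by field_simp
    have h6 : 1 / (2 * lam) * kernelForm P κ φ = 1 / 2 * (lam⁻¹ * kernelForm P κ φ) := by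
      field_simp
    rw [h6]; linarith

end Duality

/-! ### The loss as a function of the form -/

section FormLoss

variable {V : Type*} [NormedAddCommGroup V] [InnerProductSpace ℝ V] [FiniteDimensional ℝ V]
  [MeasurableSpace V] [BorelSpace V] {Ω : Type*} [MeasurableSpace Ω]
  {P : Measure Ω} [IsProbabilityMeasure P] {X : Ω → V} {Y : Ω → ℂ} {kV : V → ℝ} {K : ℝ → ℝ}
  {lam : ℝ} {S : Sym2Dual V}

/-- The kernel `𝒦(|X - X'|²_S)` on the sample space. -/
noncomputable def formKernel (K : ℝ → ℝ) (X : Ω → V) (S : Sym2Dual V) (p : Ω × Ω) : ℝ :=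
  K (formSq S (X p.1 - X p.2))

omit [FiniteDimensional ℝ V] [MeasurableSpace V] [BorelSpace V] [MeasurableSpace Ω] in
lemma formKernel_eq {U : V →L[ℝ] V} (hU : IsGramOf S U) :
    formKernel K X S = fun p => K (‖U (X p.1) - U (X p.2)‖ ^ 2) := by
  ext p
  rw [formKernel, hU.formSq_eq, map_sub]

lemma measurable_formKernel (hK : IsRadialKernel kV K) (hX : Measurable X) (hS : S ∈ symNonneg V) :
    Measurable (formKernel K X S) := by
  obtain ⟨U, hU⟩ := exists_isGramOf hS
  rw [formKernel_eq hU]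
  exact measurable_kernel hK (U.measurable.comp hX)

omit [MeasurableSpace Ω] in
lemma abs_formKernel_le (hK : IsRadialKernel kV K) (hS : S ∈ symNonneg V) (p : Ω × Ω) :
    |formKernel K X S p| ≤ 1 := by
  obtain ⟨U, hU⟩ := exists_isGramOf hS
  rw [formKernel_eq hU]
  exact hK.abs_le_one _

omit [IsProbabilityMeasure P] in
lemma exists_formLoss_eq_minLoss (hS : S ∈ symNonneg V) :
    ∃ U : V →L[ℝ] V, IsGramOf S U ∧ formLoss kV P X Y lam S = minLoss kV P X Y lam U := by
  have h := exists_isGramOf hS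
  exact ⟨h.choose, h.choose_spec, by rw [formLoss, dif_pos h]⟩

lemma dualValue_le_formLoss (hK : IsRadialKernel kV K) (hlam : 0 < lam) (hX : Measurable X)
    (hY : MemLp Y 2 P) (hS : S ∈ symNonneg V) {φ : Ω → ℂ} (hφ : MemLp φ 2 P) :
    dualValue P (formKernel K X S) Y lam φ ≤ formLoss kV P X Y lam S := by
  obtain ⟨U, hU, h⟩ := exists_formLoss_eq_minLoss (kV := kV) (P := P) (X := X) (Y := Y)
    (lam := lam) hS
  rw [h, formKernel_eq hU]
  exact dualValue_le_minLoss hK hlam hX hY hφ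

lemma exists_formLoss_le_dualValue (hK : IsRadialKernel kV K) (hlam : 0 < lam) (hX : Measurable X)
    (hY : MemLp Y 2 P) (hS : S ∈ symNonneg V) :
    ∃ φ : Ω → ℂ, MemLp φ 2 P ∧ ∫ a, ‖φ a‖ ^ 2 ∂P ≤ ∫ a, ‖Y a‖ ^ 2 ∂P ∧
      formLoss kV P X Y lam S ≤ dualValue P (formKernel K X S) Y lam φ := by
  obtain ⟨U, hU, h⟩ := exists_formLoss_eq_minLoss (kV := kV) (P := P) (X := X) (Y := Y)
    (lam := lam) hS
  rw [h, formKernel_eq hU]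
  exact exists_minLoss_le_dualValue hK hlam hX hY

omit [IsProbabilityMeasure P] in
lemma formLoss_nonneg (hlam : 0 < lam) (S : Sym2Dual V) : 0 ≤ formLoss kV P X Y lam S := by
  unfold formLoss
  split_ifs
  · refine Real.sInf_nonneg ?_
    rintro _ ⟨f, -, rfl⟩
    exact loss_nonneg hlam f
  · exact le_rfl

omit [IsProbabilityMeasure P] in
/-- The zero function shows that `𝒥 ≤ ½ 𝔼|Y|²`. -/
lemma formLoss_le_half (hlam : 0 < lam) (hS : S ∈ symNonneg V) :
    formLoss kV P X Y lam S ≤ 1 / 2 * ∫ a, ‖Y a‖ ^ 2 ∂P := by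
  obtain ⟨U, -, h⟩ := exists_formLoss_eq_minLoss (kV := kV) (P := P) (X := X) (Y := Y)
    (lam := lam) hS
  have h0 : rkhsNormSq kV (0 : V → ℂ) = 0 := rkhsNormSq_zero
  have hmem : (0 : V → ℂ) ∈ rkhs kV := by
    change rkhsNormSq kV 0 < ∞
    rw [h0]; exact ENNReal.zero_lt_top
  rw [h]
  refine (csInf_le ⟨0, ?_⟩ (mem_image_of_mem _ hmem)).trans_eq ?_
  · rintro _ ⟨f, -, rfl⟩; exact loss_nonneg hlam f
  · simp [loss, h0]

end FormLoss

/-! ### Forms that are small in some direction -/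

section SmallForms

variable {V : Type*} [NormedAddCommGroup V] [InnerProductSpace ℝ V] [FiniteDimensional ℝ V]
  [MeasurableSpace V] [BorelSpace V] {Ω : Type*} [MeasurableSpace Ω]
  {P : Measure Ω} [IsProbabilityMeasure P] {X : Ω → V} {Y : Ω → ℂ} {kV : V → ℝ} {K : ℝ → ℝ}
  {lam : ℝ} {S : Sym2Dual V}

lemma abs_sub_le_derivSupNorm_mul (hK' : HasBoundedContinuousDeriv K) {r s : ℝ} (hr : 0 ≤ r)
    (hs : 0 ≤ s) : |K r - K s| ≤ derivSupNorm K * |r - s| :=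
  (convex_Ici (0 : ℝ)).norm_image_sub_le_of_norm_derivWithin_le hK'.1
    (fun _ hx => le_csSup hK'.2.2 (mem_image_of_mem _ hx)) hs hr

lemma derivSupNorm_nonneg (K : ℝ → ℝ) : 0 ≤ derivSupNorm K := by
  refine Real.sSup_nonneg ?_
  rintro _ ⟨r, -, rfl⟩
  exact abs_nonneg _

omit [IsProbabilityMeasure P] in
lemma integral_mul_le_sqrt_mul_sqrt {f g : Ω → ℝ} (hf : MemLp f 2 P) (hg : MemLp g 2 P)
    (hf0 : 0 ≤ f) (hg0 : 0 ≤ g) :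
    ∫ a, f a * g a ∂P ≤ √(∫ a, f a ^ 2 ∂P) * √(∫ a, g a ^ 2 ∂P) := by
  have h := integral_mul_le_Lp_mul_Lq_of_nonneg (μ := P) Real.HolderConjugate.two_two
    (Eventually.of_forall hf0) (Eventually.of_forall hg0) (by simpa using hf) (by simpa using hg)
  simpa [Real.sqrt_eq_rpow] using h

/-- In `𝔼[(ξ - ξ')² v v']`, with a primed independent copy, the cross term `-2 𝔼[ξ v]²` has a sign
and can be dropped. -/
lemma integral_sub_sq_mul_mul_le {ξ v : Ω → ℝ} (hξ : MemLp ξ 2 P)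
    (hξ2 : MemLp (fun a => ξ a ^ 2) 2 P)
    (hv : MemLp v 2 P) (hv0 : 0 ≤ v) :
    Integrable (fun p : Ω × Ω => (ξ p.1 - ξ p.2) ^ 2 * (v p.1 * v p.2)) (P.prod P) ∧
    ∫ p : Ω × Ω, (ξ p.1 - ξ p.2) ^ 2 * (v p.1 * v p.2) ∂(P.prod P)
      ≤ 2 * √(∫ a, ξ a ^ 4 ∂P) * ∫ a, v a ^ 2 ∂P := by
  have hu : Integrable (fun a => ξ a ^ 2 * v a) P := hξ2.integrable_mul hv
  have hw : Integrable (fun a => ξ a * v a) P := hξ.integrable_mul hv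
  have hv1 : Integrable v P := hv.integrable one_le_two
  have hexp : (fun p : Ω × Ω => (ξ p.1 - ξ p.2) ^ 2 * (v p.1 * v p.2)) = fun p =>
      ((ξ p.1 ^ 2 * v p.1) * v p.2 + v p.1 * (ξ p.2 ^ 2 * v p.2))
        - 2 * ((ξ p.1 * v p.1) * (ξ p.2 * v p.2)) := by
    ext p; ring
  have i1 := hu.mul_prod hv1
  have i2 := hv1.mul_prod hu
  have i3 := (hw.mul_prod hw).const_mul 2
  rw [hexp]
  refine ⟨(i1.add i2).sub i3, ?_⟩
  have i12 : Integrable (fun p : Ω × Ω =>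
      (ξ p.1 ^ 2 * v p.1) * v p.2 + v p.1 * (ξ p.2 ^ 2 * v p.2)) (P.prod P) := i1.add i2
  rw [integral_sub i12 i3, integral_add i1 i2, integral_const_mul,
    integral_prod_mul (fun a => ξ a ^ 2 * v a) v, integral_prod_mul v (fun a => ξ a ^ 2 * v a),
    integral_prod_mul (fun a => ξ a * v a) (fun a => ξ a * v a)]
  have hN : 0 ≤ ∫ a, v a ^ 2 ∂P := integral_nonneg fun a => sq_nonneg _
  have h1 : ∫ a, ξ a ^ 2 * v a ∂P ≤ √(∫ a, ξ a ^ 4 ∂P) * √(∫ a, v a ^ 2 ∂P) := by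
    refine (integral_mul_le_sqrt_mul_sqrt hξ2 hv (fun a => sq_nonneg _) hv0).trans_eq ?_
    simp_rw [← pow_mul]
  have h2 : ∫ a, v a ∂P ≤ √(∫ a, v a ^ 2 ∂P) := by
    have := integral_mul_le_sqrt_mul_sqrt hv (memLp_const (1 : ℝ)) hv0 (fun a => zero_le_one)
    simpa using this
  have h3 : 0 ≤ ∫ a, v a ∂P := integral_nonneg hv0
  have h4 : (∫ a, ξ a ^ 2 * v a ∂P) * ∫ a, v a ∂P
      ≤ √(∫ a, ξ a ^ 4 ∂P) * √(∫ a, v a ^ 2 ∂P) * √(∫ a, v a ^ 2 ∂P) :=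
    mul_le_mul h1 h2 h3 (by positivity)
  rw [mul_assoc, Real.mul_self_sqrt hN] at h4
  nlinarith [mul_self_nonneg (∫ a, ξ a * v a ∂P)]

omit [IsProbabilityMeasure P] in
lemma integrable_inner_pow_four (hX : Measurable X) (hβ : fourthMomentSup P X < ∞) {e : V}
    (he : ‖e‖ = 1) :
    Integrable (fun a => ⟪e, X a⟫ ^ 4) P ∧
      √(∫ a, ⟪e, X a⟫ ^ 4 ∂P) ≤ (fourthMomentSup P X).toReal := by
  have hle : (∫⁻ a, ‖⟪X a, e⟫‖ₑ ^ 4 ∂P) ^ (1 / 2 : ℝ) ≤ fourthMomentSup P X :=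
    le_iSup₂_of_le e he le_rfl
  have hfin : ∫⁻ a, ‖⟪X a, e⟫‖ₑ ^ 4 ∂P < ∞ := by
    by_contra! h
    rw [top_le_iff.1 h, ENNReal.top_rpow_of_pos (by norm_num)] at hle
    exact hβ.not_ge hle
  have hen : ∀ a, ENNReal.ofReal (⟪e, X a⟫ ^ 4) = ‖⟪X a, e⟫‖ₑ ^ 4 := fun a => by
    rw [real_inner_comm, Real.enorm_eq_ofReal_abs, ← ENNReal.ofReal_pow (abs_nonneg _),
      Even.pow_abs (by decide)]
  have hm : Measurable fun a => ⟪e, X a⟫ ^ 4 := (measurable_const.inner hX).pow_const 4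
  have hnn : 0 ≤ᵐ[P] fun a => ⟪e, X a⟫ ^ 4 :=
    Eventually.of_forall fun a => Even.pow_nonneg (by decide) _
  refine ⟨⟨hm.aestronglyMeasurable, ?_⟩, ?_⟩
  · rw [hasFiniteIntegral_iff_ofReal hnn]
    simpa only [hen] using hfin
  · rw [integral_eq_lintegral_of_nonneg_ae hnn hm.aestronglyMeasurable, Real.sqrt_eq_rpow,
      ENNReal.toReal_rpow]
    simp_rw [hen]
    exact ENNReal.toReal_mono hβ.ne hle

/-- Near the boundary of the cone of inner products: the degenerate form obtained by removing the
smallest eigenvalue has almost the same loss. The dual optimum of the degenerate form is a test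
function for `S`, and the kernels differ by at most `‖𝒦'‖ t ⟪e, X - X'⟫²`. -/
lemma exists_degenerate_formLoss_le (hK : IsRadialKernel kV K) (hlam : 0 < lam)
    (hX : Measurable X) (hY : MemLp Y 2 P) (hK' : HasBoundedContinuousDeriv K)
    (hβ : fourthMomentSup P X < ∞) (hS : S ∈ symNonneg V) {x : V} (hx : ‖x‖ = 1) :
    ∃ T ∈ symNonneg V \ symPos V, formLoss kV P X Y lam T ≤ formLoss kV P X Y lam S
      + (fourthMomentSup P X).toReal * derivSupNorm K * formSq S x / lam
        * ∫ a, ‖Y a‖ ^ 2 ∂P := by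
  obtain ⟨e, t, T, he, ht0, htx, hT, hST⟩ := exists_degenerate_add_rankOneForm hS hx
  refine ⟨T, hT, ?_⟩
  obtain ⟨φ, hφ, hφY, hφT⟩ := exists_formLoss_le_dualValue (lam := lam) hK hlam hX hY hT.1
  have hφS := dualValue_le_formLoss hK hlam hX hY hS hφ
  set β := (fourthMomentSup P X).toReal
  set κ' := derivSupNorm K
  set m := ∫ a, ‖Y a‖ ^ 2 ∂P
  have hφ1 := hφ.integrable one_le_two
  obtain ⟨h4, hβ4⟩ := integrable_inner_pow_four hX hβ he
  have hinm : Measurable fun a => ⟪e, X a⟫ := measurable_const.inner hX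
  have hξ2 : MemLp (fun a => ⟪e, X a⟫ ^ 2) 2 P := by
    rw [memLp_two_iff_integrable_sq (hinm.pow_const 2).aestronglyMeasurable]
    simpa only [← pow_mul] using h4
  have hξ : MemLp (fun a => ⟪e, X a⟫) 2 P := by
    rw [memLp_two_iff_integrable_sq hinm.aestronglyMeasurable]
    exact hξ2.integrable one_le_two
  obtain ⟨hint, hbound⟩ := integral_sub_sq_mul_mul_le hξ hξ2 hφ.norm (fun a => norm_nonneg _)
  have hform : ∀ {R : Sym2Dual V}, R ∈ symNonneg V → Integrable (fun p : Ω × Ω =>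
      formKernel K X R p * (conj (φ p.1) * φ p.2).re) (P.prod P) := fun {R} hR => by
    have := (integrable_kernel_mul (measurable_formKernel hK hX hR)
      (fun p => abs_formKernel_le hK hR p) hφ1 hφ1).re
    refine this.congr (Eventually.of_forall fun p => ?_)
    exact Complex.re_ofReal_mul _ _
  have hdiff : kernelForm P (formKernel K X S) φ - kernelForm P (formKernel K X T) φ
      ≤ κ' * t * (2 * β * m) := by
    have h1 : kernelForm P (formKernel K X S) φ - kernelForm P (formKernel K X T) φ
        ≤ ∫ p : Ω × Ω, κ' * t * ((⟪e, X p.1⟫ - ⟪e, X p.2⟫) ^ 2 * (‖φ p.1‖ * ‖φ p.2‖))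
          ∂(P.prod P) := by
      unfold kernelForm
      rw [← integral_sub (hform hS) (hform hT.1)]
      refine integral_mono ((hform hS).sub (hform hT.1)) (hint.const_mul _) fun p => ?_
      simp only
      rw [← sub_mul]
      have h2 : |formKernel K X S p - formKernel K X T p|
          ≤ κ' * t * (⟪e, X p.1⟫ - ⟪e, X p.2⟫) ^ 2 := by
        refine (abs_sub_le_derivSupNorm_mul hK' (hS _) (hT.1 _)).trans_eq ?_
        rw [hST, add_sub_cancel_left, abs_of_nonneg (by positivity), inner_sub_right]
        ring
      have h3 : |(conj (φ p.1) * φ p.2).re| ≤ ‖φ p.1‖ * ‖φ p.2‖ := by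
        refine (Complex.abs_re_le_norm _).trans_eq ?_
        rw [norm_mul, RCLike.norm_conj]
      refine (le_abs_self _).trans ?_
      rw [abs_mul, ← mul_assoc]
      exact mul_le_mul h2 h3 (abs_nonneg _)
        (mul_nonneg (mul_nonneg (derivSupNorm_nonneg K) ht0) (sq_nonneg _))
    refine h1.trans ?_
    rw [integral_const_mul]
    refine mul_le_mul_of_nonneg_left (hbound.trans ?_)
      (mul_nonneg (derivSupNorm_nonneg K) ht0)
    gcongr
  have hdual : dualValue P (formKernel K X T) Y lam φ = dualValue P (formKernel K X S) Y lam φ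
      + 1 / (2 * lam) * (kernelForm P (formKernel K X S) φ
        - kernelForm P (formKernel K X T) φ) := by
    unfold dualValue; ring
  have hm : 0 ≤ m := integral_nonneg fun a => sq_nonneg _
  have hβ0 : 0 ≤ β := ENNReal.toReal_nonneg
  have hκ0 : 0 ≤ κ' := derivSupNorm_nonneg K
  have h5 : 1 / (2 * lam) * (kernelForm P (formKernel K X S) φ
      - kernelForm P (formKernel K X T) φ) ≤ 1 / (2 * lam) * (κ' * t * (2 * β * m)) := by gcongr
  have h6 : 1 / (2 * lam) * (κ' * t * (2 * β * m)) = β * κ' * t / lam * m := by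
    field_simp
  have h7 : β * κ' * t / lam * m ≤ β * κ' * formSq S x / lam * m := by gcongr
  linarith

end SmallForms

/-! ### Forms that are large in some direction -/

section LargeForms

variable {V : Type*} [NormedAddCommGroup V] [InnerProductSpace ℝ V] [FiniteDimensional ℝ V]
  [MeasurableSpace V] [BorelSpace V] {Ω : Type*} [MeasurableSpace Ω]
  {P : Measure Ω} [IsProbabilityMeasure P] {X : Ω → V} {Y : Ω → ℂ} {kV : V → ℝ} {K : ℝ → ℝ}
  {lam : ℝ} {S : Sym2Dual V} {ν : Measure ℝ≥0} [IsFiniteMeasure ν]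

lemma integrable_exp_neg_mul {r : ℝ} (hr : 0 ≤ r) :
    Integrable (fun t : ℝ≥0 => Real.exp (-(t : ℝ) * r)) ν :=
  Integrable.of_bound (by fun_prop) 1 (Eventually.of_forall fun t => by
    rw [Real.norm_eq_abs, Real.abs_exp, Real.exp_le_one_iff]
    nlinarith [mul_nonneg t.coe_nonneg hr])

omit [IsFiniteMeasure ν] in
lemma IsGaussianMixture.nonneg (hν : IsGaussianMixture K ν) {r : ℝ} (hr : 0 ≤ r) : 0 ≤ K r := by
  rw [hν r hr]; exact integral_nonneg fun t => (Real.exp_pos _).le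

lemma IsGaussianMixture.antitone (hν : IsGaussianMixture K ν) {r s : ℝ} (hr : 0 ≤ r) (hrs : r ≤ s) :
    K s ≤ K r := by
  rw [hν r hr, hν s (hr.trans hrs)]
  refine integral_mono (integrable_exp_neg_mul (hr.trans hrs)) (integrable_exp_neg_mul hr)
    fun t => ?_
  have := mul_le_mul_of_nonneg_left hrs t.coe_nonneg
  exact Real.exp_le_exp.2 (by linarith)

omit [IsFiniteMeasure ν] in
lemma mixtureConst_eq_lintegral_prod [SFinite ν] :
    mixtureConst ν = ∫⁻ q : ℝ≥0 × ℝ≥0,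
      (ENNReal.ofReal Real.pi / ((q.1 + q.2 : ℝ≥0) : ℝ≥0∞)) ^ (1 / 2 : ℝ) ∂(ν.prod ν) := by
  have hm : Measurable fun q : ℝ≥0 × ℝ≥0 =>
      (ENNReal.ofReal Real.pi / ((q.1 + q.2 : ℝ≥0) : ℝ≥0∞)) ^ (1 / 2 : ℝ) := by fun_prop
  rw [lintegral_prod _ hm.aemeasurable, mixtureConst]

lemma IsGaussianMixture.ofReal_sq_eq (hν : IsGaussianMixture K ν) {r : ℝ} (hr : 0 ≤ r) :
    ENNReal.ofReal (K r) ^ 2 =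
      ∫⁻ q : ℝ≥0 × ℝ≥0, ENNReal.ofReal (Real.exp (-((q.1 : ℝ) + q.2) * r)) ∂(ν.prod ν) := by
  have h1 : ENNReal.ofReal (K r) = ∫⁻ t : ℝ≥0, ENNReal.ofReal (Real.exp (-(t : ℝ) * r)) ∂ν := by
    rw [hν r hr]
    exact ofReal_integral_eq_lintegral_ofReal (integrable_exp_neg_mul hr)
      (Eventually.of_forall fun t => (Real.exp_pos _).le)
  have hm : Measurable fun t : ℝ≥0 => ENNReal.ofReal (Real.exp (-(t : ℝ) * r)) := by fun_prop
  rw [sq, h1, ← lintegral_prod_mul hm.aemeasurable hm.aemeasurable]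
  refine lintegral_congr fun q => ?_
  rw [← ENNReal.ofReal_mul (Real.exp_pos _).le, ← Real.exp_add]
  congr 2; ring

/-- The Gaussian integral in the extended reals; for `τ = 0` both sides are infinite. -/
lemma lintegral_exp_neg_mul_sub_sq_le (τ : ℝ≥0) {r : ℝ} (hr : 0 < r) (u₀ : ℝ) :
    ∫⁻ u, ENNReal.ofReal (Real.exp (-(τ : ℝ) * (r * (u₀ - u) ^ 2)))
      ≤ (ENNReal.ofReal Real.pi / (τ : ℝ≥0∞)) ^ (1 / 2 : ℝ) * ENNReal.ofReal (√r)⁻¹ := by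
  have hsr : 0 < (√r)⁻¹ := inv_pos.2 (Real.sqrt_pos.2 hr)
  rcases eq_or_ne τ 0 with rfl | hτ
  · rw [ENNReal.coe_zero, ENNReal.div_zero (by simpa using Real.pi_pos),
      ENNReal.top_rpow_of_pos (by norm_num), ENNReal.top_mul (by simpa using hsr)]
    exact le_top
  have hτ0 : 0 < (τ : ℝ) := by positivity
  have hb : 0 < (τ : ℝ) * r := by positivity
  have h1 : ∀ u, ENNReal.ofReal (Real.exp (-(τ : ℝ) * (r * (u₀ - u) ^ 2)))
      = ENNReal.ofReal (Real.exp (-((τ : ℝ) * r) * (u - u₀) ^ 2)) := fun u => by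
    congr 2; ring
  simp_rw [h1]
  rw [lintegral_sub_right_eq_self
      (fun u => ENNReal.ofReal (Real.exp (-((τ : ℝ) * r) * u ^ 2))) u₀,
    ← ofReal_integral_eq_lintegral_ofReal (integrable_exp_neg_mul_sq hb)
      (Eventually.of_forall fun u => (Real.exp_pos _).le), integral_gaussian]
  have h2 : √(Real.pi / ((τ : ℝ) * r)) = √(Real.pi / τ) * (√r)⁻¹ := by
    rw [← div_div, Real.sqrt_div (by positivity), div_eq_mul_inv]
  have h3 : ENNReal.ofReal Real.pi / (τ : ℝ≥0∞) = ENNReal.ofReal (Real.pi / τ) := by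
    rw [ENNReal.ofReal_div_of_pos hτ0, ENNReal.ofReal_coe_nnreal]
  rw [h2, ENNReal.ofReal_mul (Real.sqrt_nonneg _), h3, Real.sqrt_eq_rpow,
    ENNReal.ofReal_rpow_of_nonneg (by positivity) (by norm_num)]

/-- Under the density bound, an integral over two independent copies of `⟪X, e⟫` is controlled by
Lebesgue integrals in one variable. -/
lemma lintegral_inner_inner_le (hX : Measurable X) {p0 : ℝ} (hp0 : MarginalDensityBound P X p0)
    {e : V} (he : ‖e‖ = 1) {G : ℝ × ℝ → ℝ≥0∞} (hG : Measurable G) {c : ℝ≥0∞}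
    (hc : ∀ u₀, ∫⁻ u, G (u₀, u) ≤ c) :
    ∫⁻ p : Ω × Ω, G (⟪X p.1, e⟫, ⟪X p.2, e⟫) ∂(P.prod P) ≤ ENNReal.ofReal p0 * c := by
  obtain ⟨rho, hrho, hmap, hle⟩ := hp0 e he
  have hinm : Measurable fun a => ⟪X a, e⟫ := hX.inner measurable_const
  have hinner : ∀ u₀, ∫⁻ a, G (u₀, ⟪X a, e⟫) ∂P ≤ ENNReal.ofReal p0 * c := fun u₀ => by
    have hGu : Measurable fun u => G (u₀, u) := hG.comp measurable_prodMk_left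
    calc ∫⁻ a, G (u₀, ⟪X a, e⟫) ∂P = ∫⁻ u, G (u₀, u) ∂(P.map fun a => ⟪X a, e⟫) :=
          (lintegral_map hGu hinm).symm
      _ = ∫⁻ u, rho u * G (u₀, u) := by
          rw [hmap, lintegral_withDensity_eq_lintegral_mul _ hrho hGu]; rfl
      _ ≤ ∫⁻ u, ENNReal.ofReal p0 * G (u₀, u) := by
          refine lintegral_mono_ae ?_
          filter_upwards [hle] with u hu
          gcongr
      _ = ENNReal.ofReal p0 * ∫⁻ u, G (u₀, u) := lintegral_const_mul _ hGu
      _ ≤ _ := by gcongr; exact hc u₀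
  have hGX : Measurable fun p : Ω × Ω => G (⟪X p.1, e⟫, ⟪X p.2, e⟫) :=
    hG.comp ((hinm.comp measurable_fst).prodMk (hinm.comp measurable_snd))
  rw [lintegral_prod _ hGX.aemeasurable]
  refine (lintegral_mono fun a => hinner ⟪X a, e⟫).trans_eq ?_
  simp

/-- The Hilbert–Schmidt norm of the kernel `𝒦(r ⟪e, X - X'⟫²)` decays like `r^{-1/4}`. -/
lemma lintegral_kernel_sq_le (hν : IsGaussianMixture K ν) (hX : Measurable X) {p0 : ℝ}
    (hp0 : MarginalDensityBound P X p0) {e : V} (he : ‖e‖ = 1) {r : ℝ} (hr : 0 < r) :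
    ∫⁻ p : Ω × Ω, ENNReal.ofReal (K (r * ⟪e, X p.1 - X p.2⟫ ^ 2)) ^ 2 ∂(P.prod P)
      ≤ ENNReal.ofReal p0 * (mixtureConst ν * ENNReal.ofReal (√r)⁻¹) := by
  have hGm : Measurable fun z : ℝ × ℝ => ∫⁻ q : ℝ≥0 × ℝ≥0,
      ENNReal.ofReal (Real.exp (-((q.1 : ℝ) + q.2) * (r * (z.1 - z.2) ^ 2))) ∂(ν.prod ν) := by
    refine Measurable.lintegral_prod_right' (f := fun z : (ℝ × ℝ) × (ℝ≥0 × ℝ≥0) =>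
      ENNReal.ofReal (Real.exp (-((z.2.1 : ℝ) + z.2.2) * (r * (z.1.1 - z.1.2) ^ 2)))) ?_
    fun_prop
  have hm : Measurable fun q : ℝ≥0 × ℝ≥0 =>
      (ENNReal.ofReal Real.pi / ((q.1 + q.2 : ℝ≥0) : ℝ≥0∞)) ^ (1 / 2 : ℝ) := by fun_prop
  refine le_trans (le_of_eq (lintegral_congr fun p => ?_))
    (lintegral_inner_inner_le hX hp0 he hGm fun u₀ => ?_)
  · rw [hν.ofReal_sq_eq (by positivity), inner_sub_right, real_inner_comm (X p.1) e,
      real_inner_comm (X p.2) e]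
  -- by Tonelli, the Gaussian integral over the line comes first
  · have hsw : Measurable fun z : ℝ × (ℝ≥0 × ℝ≥0) =>
        ENNReal.ofReal (Real.exp (-((z.2.1 : ℝ) + z.2.2) * (r * (u₀ - z.1) ^ 2))) := by fun_prop
    rw [lintegral_lintegral_swap hsw.aemeasurable, mixtureConst_eq_lintegral_prod,
      ← lintegral_mul_const _ hm]
    refine lintegral_mono fun q => ?_
    have := lintegral_exp_neg_mul_sub_sq_le (q.1 + q.2) hr u₀
    rwa [NNReal.coe_add] at this

/-- The Hermitian form of a kernel is bounded by its Hilbert–Schmidt norm. -/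
lemma kernelForm_le_of_integral_sq_le {κ : Ω × Ω → ℝ} (hκ : Measurable κ) (hκ1 : ∀ p, |κ p| ≤ 1)
    (hY : MemLp Y 2 P) (hY0 : 0 < ∫ a, ‖Y a‖ ^ 2 ∂P) {c : ℝ} (hc : 0 < c)
    (h : ∫ p, κ p ^ 2 ∂(P.prod P) ≤ c ^ 2) : kernelForm P κ Y ≤ c * ∫ a, ‖Y a‖ ^ 2 ∂P := by
  set m := ∫ a, ‖Y a‖ ^ 2 ∂P with hm
  have hY1 := hY.integrable one_le_two
  have i1 : Integrable (fun p : Ω × Ω => κ p * (conj (Y p.1) * Y p.2).re) (P.prod P) :=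
    (integrable_kernel_mul hκ hκ1 hY1 hY1).re.congr
      (Eventually.of_forall fun p => Complex.re_ofReal_mul _ _)
  have i2 : Integrable (fun p : Ω × Ω => ‖Y p.1‖ ^ 2 * ‖Y p.2‖ ^ 2) (P.prod P) :=
    (integrable_norm_sq hY).mul_prod (integrable_norm_sq hY)
  have i3 : Integrable (fun p : Ω × Ω => κ p ^ 2) (P.prod P) :=
    Integrable.of_bound (hκ.pow_const 2).aestronglyMeasurable 1 (Eventually.of_forall fun p => by
      rw [norm_pow, Real.norm_eq_abs]
      exact pow_le_one₀ (abs_nonneg _) (hκ1 p))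
  -- Young's inequality with the weight which is optimal for the given bound
  have hle : kernelForm P κ Y ≤ ∫ p : Ω × Ω, (c / (2 * m) * (‖Y p.1‖ ^ 2 * ‖Y p.2‖ ^ 2)
      + m / (2 * c) * κ p ^ 2) ∂(P.prod P) := by
    refine integral_mono i1 ((i2.const_mul _).add (i3.const_mul _)) fun p => ?_
    simp only
    have h3 : |(conj (Y p.1) * Y p.2).re| ≤ ‖Y p.1‖ * ‖Y p.2‖ := by
      refine (Complex.abs_re_le_norm _).trans_eq ?_
      rw [norm_mul, RCLike.norm_conj]
    refine (le_abs_self _).trans ?_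
    rw [abs_mul]
    refine (mul_le_mul_of_nonneg_left h3 (abs_nonneg _)).trans ?_
    rw [← sq_abs (κ p)]
    set w := ‖Y p.1‖ * ‖Y p.2‖
    have e1 : ‖Y p.1‖ ^ 2 * ‖Y p.2‖ ^ 2 = w ^ 2 := by rw [mul_pow]
    have e2 : c / (2 * m) * w ^ 2 + m / (2 * c) * |κ p| ^ 2 - |κ p| * w
        = (c * w - m * |κ p|) ^ 2 / (2 * m * c) := by field_simp; ring
    have e3 : 0 ≤ (c * w - m * |κ p|) ^ 2 / (2 * m * c) := by positivity
    rw [e1]; linarith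
  rw [integral_add (i2.const_mul _) (i3.const_mul _), integral_const_mul, integral_const_mul,
    integral_prod_mul (fun a => ‖Y a‖ ^ 2) (fun a => ‖Y a‖ ^ 2), ← hm] at hle
  have h4 : m / (2 * c) * ∫ p, κ p ^ 2 ∂(P.prod P) ≤ m / (2 * c) * c ^ 2 := by gcongr
  have h5 : c / (2 * m) * (m * m) + m / (2 * c) * c ^ 2 = c * m := by field_simp; ring
  linarith

/-- A form which is large in some direction has almost the loss of the zero function: the kernel
operator is small in Hilbert–Schmidt norm, and `Y` is a test function for the dual problem. -/
lemma half_sub_mul_le_formLoss (hK : IsRadialKernel kV K) (hlam : 0 < lam) (hX : Measurable X)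
    (hY : MemLp Y 2 P) (hY0 : 0 < ∫ a, ‖Y a‖ ^ 2 ∂P) (hν : IsGaussianMixture K ν)
    (hC : mixtureConst ν < ∞) {p0 : ℝ} (hp0 : MarginalDensityBound P X p0) {eps : ℝ}
    (heps : 0 < eps) (hS : S ∈ symNonneg V) {x : V} (hx : ‖x‖ = 1) (hSx : 0 < formSq S x)
    (hbig : ((mixtureConst ν).toReal * p0) ^ 2 * ((lam * eps) ^ 4)⁻¹ ≤ 16 * formSq S x) :
    (1 / 2 - eps) * ∫ a, ‖Y a‖ ^ 2 ∂P ≤ formLoss kV P X Y lam S := by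
  obtain ⟨e, he, hSe⟩ := exists_unit_mul_inner_sq_le_formSq hS hx hSx
  set r := formSq S x
  set C := (mixtureConst ν).toReal
  have hsr : 0 < √r := Real.sqrt_pos.2 hSx
  have hle : 0 < lam * eps := mul_pos hlam heps
  have hnum : C * max p0 0 * (√r)⁻¹ ≤ (2 * (lam * eps)) ^ 2 := by
    have hC0 : 0 ≤ C := ENNReal.toReal_nonneg
    have h1 : (C * max p0 0) ^ 2 ≤ (C * p0) ^ 2 := by
      rw [mul_pow, mul_pow]
      gcongr 1
      rw [sq_le_sq, abs_of_nonneg (le_max_right p0 0)]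
      exact max_le (le_abs_self _) (abs_nonneg _)
    have h2 : (C * p0) ^ 2 ≤ 16 * r * (lam * eps) ^ 4 := by
      rwa [← div_eq_mul_inv, div_le_iff₀ (by positivity)] at hbig
    have h3 : (C * max p0 0) ^ 2 ≤ ((2 * (lam * eps)) ^ 2 * √r) ^ 2 := by
      rw [mul_pow _ (√r), Real.sq_sqrt hSx.le]
      linarith
    have h4 := le_of_sq_le_sq h3 (by positivity)
    rwa [← div_eq_mul_inv, div_le_iff₀ hsr]
  have hHS : ∫ p, formKernel K X S p ^ 2 ∂(P.prod P) ≤ (2 * (lam * eps)) ^ 2 := by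
    refine le_trans ?_ hnum
    rw [integral_eq_lintegral_of_nonneg_ae (Eventually.of_forall fun p => sq_nonneg _)
      ((measurable_formKernel hK hX hS).pow_const 2).aestronglyMeasurable]
    refine ENNReal.toReal_le_of_le_ofReal
      (mul_nonneg (mul_nonneg ENNReal.toReal_nonneg (le_max_right _ _)) (inv_pos.2 hsr).le) ?_
    refine le_trans (lintegral_mono fun p => ?_)
      ((lintegral_kernel_sq_le hν hX hp0 he hSx).trans_eq ?_)
    · rw [formKernel, ENNReal.ofReal_pow (hν.nonneg (hS _))]
      gcongr
      exact hν.antitone (by positivity) (hSe _)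
    · rw [ENNReal.ofReal_mul (mul_nonneg ENNReal.toReal_nonneg (le_max_right _ _)),
        ENNReal.ofReal_mul ENNReal.toReal_nonneg, ENNReal.ofReal_toReal hC.ne,
        ENNReal.ofReal_max, ENNReal.ofReal_zero, max_eq_left zero_le]
      ring
  have hQ := kernelForm_le_of_integral_sq_le (measurable_formKernel hK hX hS)
    (abs_formKernel_le hK hS) hY hY0 (by positivity) hHS
  refine le_trans ?_ (dualValue_le_formLoss hK hlam hX hY hS hY)
  have hYY : ∫ a, (conj (Y a) * Y a).re ∂P = ∫ a, ‖Y a‖ ^ 2 ∂P := by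
    congr 1; ext a
    rw [← Complex.normSq_eq_conj_mul_self, Complex.ofReal_re, Complex.normSq_eq_norm_sq]
  rw [dualValue, hYY]
  set m := ∫ a, ‖Y a‖ ^ 2 ∂P
  have h5 : 1 / (2 * lam) * kernelForm P (formKernel K X S) Y
      ≤ 1 / (2 * lam) * (2 * (lam * eps) * m) := by gcongr
  have h6 : 1 / (2 * lam) * (2 * (lam * eps) * m) = eps * m := by field_simp
  linarith

end LargeForms

end KernelLearning

/-! ### Vacua and scale detectors -/

theorem mainTheorem4 {V : Type*} [NormedAddCommGroup V] [InnerProductSpace ℝ V]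
    [FiniteDimensional ℝ V] [Nontrivial V] [MeasurableSpace V] [BorelSpace V]
    {Ω : Type*} [MeasurableSpace Ω] (P : Measure Ω) [IsProbabilityMeasure P]
    (X : Ω → V) (hX : Measurable X)
    (Y : Ω → ℂ) (hY : MemLp Y 2 P) (hY0 : 0 < ∫ a, ‖Y a‖ ^ 2 ∂P)
    (kV : V → ℝ) (K : ℝ → ℝ) (hK : IsRadialKernel kV K)
    (lam eps p0 : ℝ) (hlam : 0 < lam) (heps : 0 < eps)
    (hED : EssentialDependence (formLoss kV P X Y lam) (∫ a, ‖Y a‖ ^ 2 ∂P) eps)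
    (hK' : HasBoundedContinuousDeriv K)
    (hbeta : fourthMomentSup P X < ∞)
    (ν : Measure ℝ≥0) [IsFiniteMeasure ν] (hν : IsGaussianMixture K ν)
    (hC : mixtureConst ν < ∞)
    (hp0 : MarginalDensityBound P X p0)
    (L : ℝ)
    (hL : L = max
      ((fourthMomentSup P X).toReal * derivSupNorm K / (2 * eps * lam))
      (((mixtureConst ν).toReal * p0) ^ 2 * ((lam * eps) ^ 4)⁻¹))
    (p : PartialCompactification V)
    (hp : IsGlobalMinimizingVacuum (formLoss kV P X Y lam) p) :
    ∃ (S : Sym2Dual V) (hS : S ∈ symNonneg V), p = PartialCompactification.form S hS ∧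
      S ∈ nbhd (ambientForm V) L ∧
      IsScaleDetector (formLoss kV P X Y lam) (∫ a, ‖Y a‖ ^ 2 ∂P) eps (L ^ 2) S := by
  set J := formLoss kV P X Y lam with hJ
  set m := ∫ a, ‖Y a‖ ^ 2 ∂P with hm
  set b := (fourthMomentSup P X).toReal * derivSupNorm K with hb
  set D := sInf (J '' (symNonneg V \ symPos V)) with hD
  have hbL : b ≤ 2 * eps * lam * L := by
    have h : b / (2 * eps * lam) ≤ L := hL ▸ le_max_left _ _
    rwa [div_le_iff₀ (by positivity), mul_comm] at h
  have hCL : ((mixtureConst ν).toReal * p0) ^ 2 * ((lam * eps) ^ 4)⁻¹ ≤ L :=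
    hL ▸ le_max_right _ _
  have hem : 0 < eps * m := mul_pos heps hY0
  obtain ⟨x₀, hx₀⟩ := exists_norm_eq V zero_le_one
  have hDle : ∀ T ∈ symNonneg V \ symPos V, D ≤ J T := fun T hT =>
    csInf_le ⟨0, by rintro _ ⟨T, -, rfl⟩; exact formLoss_nonneg hlam T⟩ (mem_image_of_mem J hT)
  have hDhalf : D ≤ 1 / 2 * m := by
    have h0 : (0 : Sym2Dual V) ∈ symNonneg V := fun x => by simp [formSq]
    refine (hDle 0 ⟨h0, fun h => ?_⟩).trans (formLoss_le_half hlam h0)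
    have := h x₀ (by rintro rfl; simp at hx₀)
    simp [formSq] at this
  -- forms which are small, respectively large, in some direction
  have hsmall : ∀ T ∈ symNonneg V, ∀ x, ‖x‖ = 1 → D ≤ J T + 2 * (L * formSq T x) * (eps * m) := by
    intro T hT x hx
    obtain ⟨T', hT', hle⟩ := exists_degenerate_formLoss_le hK hlam hX hY hK' hbeta hT hx
    refine (hDle T' hT').trans (hle.trans ?_)
    have h1 : b * formSq T x / lam ≤ 2 * eps * lam * L * formSq T x / lam := by
      have := hT x
      gcongr
    have h2 : 2 * eps * lam * L * formSq T x / lam * m = 2 * (L * formSq T x) * (eps * m) := by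
      field_simp
    have h3 := mul_le_mul_of_nonneg_right h1 hY0.le
    rw [h2] at h3
    exact add_le_add_right h3 _
  have hlarge : ∀ T ∈ symNonneg V, ∀ x, ‖x‖ = 1 → 0 < formSq T x → L ≤ 16 * formSq T x →
      1 / 2 * m - eps * m ≤ J T := fun T hT x hx hpos hLx => by
    have := half_sub_mul_le_formLoss hK hlam hX hY hY0 hν hC hp0 heps hT hx hpos (hCL.trans hLx)
    rwa [sub_mul] at this
  obtain ⟨v, hv, hmin⟩ := hp
  have hvle : ∀ T ∈ symNonneg V, v ≤ J T := fun T hT => hmin (.form T hT) _ rfl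
  have hvD : v ≤ D - 2 * (eps * m) := by
    have h1 : v ≤ sInf (J '' symPos V) := by
      refine le_csInf ⟨_, mem_image_of_mem J
          (show ambientForm V ∈ symPos V from fun x hx => ?_)⟩ ?_
      · rw [formSq_ambientForm]
        have := norm_pos_iff.2 hx
        positivity
      · rintro _ ⟨T, hT, rfl⟩
        exact hvle T (symPos_subset_symNonneg hT)
    have h2 : sInf (J '' symPos V) ≤ D - 2 * eps * m := hED
    linarith
  cases p with
  | infinity W hW SW hSW =>
    exfalso
    obtain ⟨S, hS⟩ := exists_tendstoInfinity W hSW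
    have hlim := hv S hS
    obtain ⟨hSpos, -, R, hR, hRle⟩ := hS
    obtain ⟨y, hy, hy0⟩ := Wᗮ.ne_bot_iff.1 (mt Submodule.orthogonal_eq_bot_iff.1 hW)
    have hx : ‖y‖⁻¹ • y ∈ Wᗮ := Wᗮ.smul_mem _ hy
    have hge : 1 / 2 * m - eps * m ≤ v := by
      refine ge_of_tendsto hlim ?_
      filter_upwards [hR.eventually_ge_atTop (max 1 L)] with i hi
      have h1 := hRle i _ hx 0 W.zero_mem
      rw [add_zero, norm_inv_norm_smul hy0] at h1
      have h2 := (le_max_left 1 L).trans hi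
      have h3 := (le_max_right 1 L).trans hi
      have h4 : R i ≤ R i ^ 2 := by nlinarith
      exact hlarge (S i) (symPos_subset_symNonneg (hSpos i)) _ (norm_inv_norm_smul hy0)
        (by linarith) (by linarith)
    linarith
  | form S hS =>
    have hJS : J S = v := hv
    have hSpos : S ∈ symPos V := by
      by_contra h
      have := hDle S ⟨hS, h⟩
      linarith
    have hpos1 : ∀ x, ‖x‖ = 1 → 0 < formSq S x := fun x hx =>
      hSpos x (by rintro rfl; simp at hx)
    have hup : ∀ x, ‖x‖ = 1 → 16 * formSq S x < L := fun x hx => by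
      by_contra! h
      have := hlarge S hS x hx (hpos1 x hx) h
      linarith
    have hlow : ∀ x, ‖x‖ = 1 → 1 ≤ L * formSq S x := fun x hx => by
      have h1 := hsmall S hS x hx
      have h2 : 1 * (eps * m) ≤ (L * formSq S x) * (eps * m) := by linarith
      exact le_of_mul_le_mul_right h2 hem
    have hL0 : 0 < L := by linarith [hup x₀ hx₀, hpos1 x₀ hx₀]
    have hL1 : 1 < L := by nlinarith [hup x₀ hx₀, hlow x₀ hx₀]
    refine ⟨S, hS, rfl, ⟨hSpos, fun x => ?_, fun x => ?_⟩, heps, by nlinarith, hSpos, ?_,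
      fun T hT => hJS ▸ hvle T (symPos_subset_symNonneg hT.1), fun T hT => ?_⟩
    · rw [formSq_coe_smul, formSq_ambientForm]
      rcases eq_or_ne x 0 with rfl | hx
      · simp [formSq]
      · rw [formSq_eq_norm_sq_mul S x, mul_comm]
        gcongr
        rw [inv_le_iff_one_le_mul₀' hL0]
        exact hlow _ (norm_inv_norm_smul hx)
    · rw [formSq_coe_smul, formSq_ambientForm]
      rcases eq_or_ne x 0 with rfl | hx
      · simp [formSq]
      · rw [formSq_eq_norm_sq_mul S x, mul_comm L]
        have h1 := hup _ (norm_inv_norm_smul hx)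
        have h2 := hpos1 _ (norm_inv_norm_smul hx)
        gcongr
        linarith
    · filter_upwards [self_mem_nhdsWithin] with T hT
      exact hJS ▸ hvle T hT
    · obtain ⟨hT0, x, hx, hTx | hTx⟩ :=
        exists_eq_of_mem_frontier_nbhd hSpos (pow_pos hL0 2) hT
      -- the upper bound has a factor `16` to spare, which offsets the loss of a factor `2` here
      · have h1 := hsmall T hT0 x hx
        have h2 : L * formSq T x ≤ 1 / 16 := by
          have h3 : L * formSq T x = formSq S x / L := by rw [hTx]; field_simp
          rw [h3, div_le_iff₀ hL0]
          linarith [hup x hx]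
        have h4 := mul_le_mul_of_nonneg_right h2 hem.le
        linarith
      · have h1 : L ≤ formSq T x := by nlinarith [hlow x hx]
        have h2 := hlarge T hT0 x hx (by linarith) (by linarith)
        linarith
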